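/- **Setting.** Let $M$ be a smooth manifold of dimension $n\ge 4$ with a conformal structure of Lorentzian signature $(n-1,1)$, that is, a full class of Lorentzian metrics differing by smooth everywhere positive factors. In the scale given by a metric $g$ of the class, with Levi-Civita connection $\nabla$ and Schouten tensor $\mathsf P=\frac1{n-2}\bigl(\mathrm{Ric}-\frac{\mathrm{Scal}}{2(n-1)}g\bigr)$, standard tractors are triples $(\sigma,\mu^a,\rho)$, with the tractor metric $\langle(\sigma,\mu,\rho),(\tau,\nu,\pi)\rangle=\mu_a\nu^a+\sigma\pi+\rho\tau$ and the tractor connection $$\nabla_a(\sigma,\mu^b,\rho)=(\nabla_a\sigma-\mu_a,\ \nabla_a\mu^b+\delta_a{}^b\rho+\mathsf P_a{}^b\sigma,\ \nabla_a\rho-\mathsf P_{ac}\mu^c).$$ Let $\Gamma$ be a smooth curve in $M$, parametrized by $t$ in an open interval, with tangent vector $U^a$; write $'$ for $\frac{d}{dt}=U^c\nabla_c$, on tensors and on tractors along $\Gamma$. The curve is *null* if $U^a\neq0$ and $U_cU^c=0$ everywhere and $U'_cU'^c$ vanishes nowhere. Then put $u=\sqrt{U'_cU'^c}$, $\mathbf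 T=(0,0,u^{-1})$, $\mathbf U=\mathbf T'$, $\mathbf U^{(j)}=\frac{d^j}{dt^j}\mathbf U$, and let $\Delta_i$ be the Gram determinant of the first $i$ tractors of the sequence $\mathbf T,\mathbf U,\mathbf U',\mathbf U'',\dots$. The curve is *generic* if the $n+2$ tractors $\mathbf T,\mathbf U,\dots,\mathbf U^{(n)}$ are linearly independent at every point. A *conformal pseudo-arc-length* is a parameter $s$ with $ds=\Delta_6^{1/6}\,dt$. With respect to $s$ (all derived tractors formed with $\frac{d}{ds}$), and with $\alpha=\langle\mathbf U'',\mathbf U''\rangle$, $\beta=\langle\mathbf U''',\mathbf U'''\rangle$, the *tractor Frenet frame* is $$\mathbf U_0=\mathbf T,\quad \mathbf U_1=\mathbf U,\quad \mathbf U_2=\mathbf U',\quad \mathbf U_3=-\mathbf U''-\tfrac12\alpha\,\mathbf U,\quad \mathbf U_4=\mathbf U'''+\alpha\,\mathbf U'+\tfrac12\alpha'\,\mathbf U+\tfrac12(\alpha^2-\beta)\,\mathbf T,$$ and, for $i=5,\dots,n+1$, $\mathbf U_i=\mathbf V_i/\sqrt{\langle\mathbf V_i,\mathbf V_i\rangle}$,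 where $\mathbf V_i$ is the component of $\mathbf U^{(i-1)}$ orthogonal to the span of $\mathbf U_0,\dots,\mathbf U_{i-1}$. The *higher conformal curvatures* are $$K_i=\Bigl\langle \tfrac{d}{ds}\mathbf U_{i+2},\ \mathbf U_{i+3}\Bigr\rangle,\qquad i=3,\dots,n-2 .$$ **Theorem.** For a generic null curve in $M$ with an arbitrary parametrization $t$, at every point of the curve, $$K_i=\frac{\sqrt{\Delta_{i+2}\,\Delta_{i+4}}}{\Delta_{i+3}\,\sqrt[6]{\Delta_6}},\qquad i=3,\dots,n-2,$$ where $K_i$ is formed with respect to a conformal pseudo-arc-length $s$ and the $\Delta_j$ are formed with respect to $t$. (The identity is asserted in every scale of the conformal class, all quantities being computed in that scale.) -/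

import Mathlib

open scoped Manifold ContDiff Bundle

namespace ConfCurve

/-! ### Lorentzian conformal manifolds -/

section Conformal

variable (n : ℕ) (M : Type*) [TopologicalSpace M] [ChartedSpace (EuclideanSpace ℝ (Fin n)) M]
  [IsManifold (𝓡 n) ∞ M]

/-- A smooth pseudo-Riemannian metric of signature `(n - 1, 1)` on the `n`-manifold `M`. -/
structure LorentzianMetric where
  val : ∀ p : M, TangentSpace (𝓡 n) p →L[ℝ] TangentSpace (𝓡 n) p →L[ℝ] ℝ
  symm : ∀ (p : M) (v w : TangentSpace (𝓡 n) p), val p v w = val p w v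
  signature : ∀ p : M, ∃ (b : Module.Basis (Fin n) ℝ (TangentSpace (𝓡 n) p)) (k : Fin n),
    ∀ i j, val p (b i) (b j) = if i = j then (if i = k then -1 else 1) else 0
  contMDiff : ContMDiff (𝓡 n)
    ((𝓡 n).prod 𝓘(ℝ, EuclideanSpace ℝ (Fin n) →L[ℝ] EuclideanSpace ℝ (Fin n) →L[ℝ] ℝ)) ∞
    (fun p ↦ Bundle.TotalSpace.mk'
      (EuclideanSpace ℝ (Fin n) →L[ℝ] EuclideanSpace ℝ (Fin n) →L[ℝ] ℝ)
      (E := fun p : M ↦ TangentSpace (𝓡 n) p →L[ℝ] TangentSpace (𝓡 n) p →L[ℝ] ℝ) p (val p))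

/-- A conformal structure of Lorentzian signature: a full class of metrics that differ from each
other by a smooth everywhere positive factor.  Its members are the scales. -/
structure LorentzianConformalStructure where
  metrics : Set (LorentzianMetric n M)
  nonempty : metrics.Nonempty
  mem_iff : ∀ g ∈ metrics, ∀ h : LorentzianMetric n M, h ∈ metrics ↔
    ∃ f : M → ℝ, ContMDiff (𝓡 n) 𝓘(ℝ, ℝ) ∞ f ∧ (∀ p, 0 < f p) ∧
      ∀ (p : M) (v w : TangentSpace (𝓡 n) p), h.val p v w = f p * g.val p v w

end Conformal

/-! ### Levi-Civita connection and Schouten tensor of a metric `G = (G i j)` in coordinates -/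

section Coordinates

variable {n : ℕ}

/-- The partial derivative `∂ᵢ f`. -/
noncomputable def pderiv (i : Fin n) (f : EuclideanSpace ℝ (Fin n) → ℝ)
    (y : EuclideanSpace ℝ (Fin n)) : ℝ :=
  fderiv ℝ f y (EuclideanSpace.single i 1)

variable (G : EuclideanSpace ℝ (Fin n) → Matrix (Fin n) (Fin n) ℝ)

/-- The Christoffel symbol `Γᵏᵢⱼ` of the Levi-Civita connection. -/
noncomputable def christoffel (y : EuclideanSpace ℝ (Fin n)) (k i j : Fin n) : ℝ :=
  1 / 2 * ∑ l, (G y)⁻¹ k l *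
    (pderiv i (fun z ↦ G z j l) y + pderiv j (fun z ↦ G z i l) y - pderiv l (fun z ↦ G z i j) y)

/-- The Ricci tensor (sign convention: positive on round spheres). -/
noncomputable def ricci (y : EuclideanSpace ℝ (Fin n)) (i j : Fin n) : ℝ :=
  ∑ k, (pderiv k (fun z ↦ christoffel G z k i j) y - pderiv j (fun z ↦ christoffel G z k i k) y
    + ∑ l, (christoffel G y k k l * christoffel G y l i j
      - christoffel G y k j l * christoffel G y l i k))

/-- The scalar curvature. -/
noncomputable def scalarCurvature (y : EuclideanSpace ℝ (Fin n)) : ℝ :=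
  ∑ i, ∑ j, (G y)⁻¹ i j * ricci G y i j

/-- The Schouten tensor `Pᵢⱼ`. -/
noncomputable def schouten (y : EuclideanSpace ℝ (Fin n)) (i j : Fin n) : ℝ :=
  1 / ((n : ℝ) - 2) * (ricci G y i j - scalarCurvature G y / (2 * ((n : ℝ) - 1)) * G y i j)

/-- The scalar product `G(v, w)` at the point `y`. -/
noncomputable def metricAt (y v w : EuclideanSpace ℝ (Fin n)) : ℝ :=
  ∑ i, ∑ j, G y i j * v i * w j

/-- The covariant derivative `D/dt = Uᶜ∇_c` of a vector field `v` along the curve `x`, where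
`U = dx/dt`. -/
noncomputable def covDeriv (x v : ℝ → EuclideanSpace ℝ (Fin n)) (t : ℝ) :
    EuclideanSpace ℝ (Fin n) :=
  WithLp.toLp 2 fun k ↦ deriv (fun τ ↦ v τ k) t
    + ∑ i, ∑ j, christoffel G (x t) k i j * (deriv x t) i * v t j

/-! ### Standard tractors -/

/-- A fibre of the standard tractor bundle, `E[1] ⊕ Eᵃ[-1] ⊕ E[-1]`, in a scale and a chart:
the triples `(σ, μᵃ, ρ)`. -/
abbrev Tractor (n : ℕ) : Type := ℝ × EuclideanSpace ℝ (Fin n) × ℝ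

/-- The standard tractor metric `μ_a νᵃ + σ π + ρ τ` of `V = (σ, μ, ρ)` and `W = (τ, ν, π)`
at the point `y`. -/
noncomputable def tractorMetric (y : EuclideanSpace ℝ (Fin n)) (V W : Tractor n) : ℝ :=
  metricAt G y V.2.1 W.2.1 + V.1 * W.2.2 + V.2.2 * W.1

/-- The derivative `d/dt = Uᶜ∇_c` of a tractor field `V = (σ, μ, ρ)` along the curve `x` for the
standard tractor connection
`∇_a (σ, μᵇ, ρ) = (∇_a σ - μ_a, ∇_a μᵇ + δ_aᵇ ρ + P_aᵇ σ, ∇_a ρ - P_{ac} μᶜ)`. -/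
noncomputable def tractorDeriv (x : ℝ → EuclideanSpace ℝ (Fin n)) (V : ℝ → Tractor n) (t : ℝ) :
    Tractor n :=
  (deriv (fun τ ↦ (V τ).1) t - metricAt G (x t) (deriv x t) (V t).2.1,
   covDeriv G x (fun τ ↦ (V τ).2.1) t + (V t).2.2 • deriv x t
     + (V t).1 • WithLp.toLp 2 (fun b ↦
        ∑ c, (G (x t))⁻¹ b c * ∑ a, schouten G (x t) a c * (deriv x t) a),
   deriv (fun τ ↦ (V τ).2.2) t
     - ∑ a, ∑ c, schouten G (x t) a c * (deriv x t) a * (V t).2.1 c)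

/-! ### Tractors along a null curve `x` -/

variable (x : ℝ → EuclideanSpace ℝ (Fin n))

/-- The acceleration `U'ᵃ`, where `U = dx/dt`. -/
noncomputable def acceleration (t : ℝ) : EuclideanSpace ℝ (Fin n) :=
  covDeriv G x (deriv x) t

/-- The curve `x` is null (that is, `1`-null) at `t`: the tangent vector `U` is nonzero and null,
and `U'` is not null. -/
def IsNullAt (t : ℝ) : Prop :=
  deriv x t ≠ 0 ∧ metricAt G (x t) (deriv x t) (deriv x t) = 0 ∧
    metricAt G (x t) (acceleration G x t) (acceleration G x t) ≠ 0

/-- The derived sequence `T, U, U', U'', …` of tractors: `derived 0` is the lift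
`T = (0, 0, u⁻¹)` with `u = √(U'_c U'ᶜ)`, and `derived (j + 1)` is the derivative of
`derived j`. -/
noncomputable def derived : ℕ → ℝ → Tractor n
  | 0 => fun t ↦
      (0, 0, (√(metricAt G (x t) (acceleration G x t) (acceleration G x t)))⁻¹)
  | j + 1 => tractorDeriv G x (derived j)

/-- The Gram determinant `Δᵢ` of the first `i` tractors of the derived sequence. -/
noncomputable def gramDet (i : ℕ) (t : ℝ) : ℝ :=
  (Matrix.of fun a b : Fin i ↦
    tractorMetric G (x t) (derived G x a t) (derived G x b t)).det

/-- The curve is generic at `t`: the tractors `T, U, …, U⁽ⁿ⁾` (`n + 2` in number) are linearly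
independent. -/
def IsGenericAt (t : ℝ) : Prop :=
  LinearIndependent ℝ fun j : Fin (n + 2) ↦ derived G x j t

/-- `α = ⟨U'', U''⟩`. -/
noncomputable def alpha (t : ℝ) : ℝ :=
  tractorMetric G (x t) (derived G x 3 t) (derived G x 3 t)

/-- `β = ⟨U''', U'''⟩`. -/
noncomputable def beta (t : ℝ) : ℝ :=
  tractorMetric G (x t) (derived G x 4 t) (derived G x 4 t)

/-- The first five tractors `U₀, …, U₄` of the tractor Frenet frame:
`U₀ = T`, `U₁ = U`, `U₂ = U'`, `U₃ = -U'' - ½ α U`,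
`U₄ = U''' + α U' + ½ α' U + ½ (α² - β) T`. -/
noncomputable def frenetHead (t : ℝ) : Fin 5 → Tractor n :=
  ![derived G x 0 t,
    derived G x 1 t,
    derived G x 2 t,
    -derived G x 3 t - (1 / 2 * alpha G x t) • derived G x 1 t,
    derived G x 4 t + alpha G x t • derived G x 2 t
      + (1 / 2 * deriv (alpha G x) t) • derived G x 1 t
      + (1 / 2 * (alpha G x t ^ 2 - beta G x t)) • derived G x 0 t]

/-- The remaining tractors of the tractor Frenet frame, `frenetTail m = U_{m+5}`, obtained by the
Gram-Schmidt process: `Uᵢ = Vᵢ / √⟨Vᵢ, Vᵢ⟩`, where `Vᵢ` is `U⁽ⁱ⁻¹⁾ = derived i` minus its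
projection to the span of `U₀, …, Uᵢ₋₁`. As `⟨U_j, U_{4-j}⟩ = 1` for `j ≤ 4`, the component along
`U_j` of a tractor `W` is `⟨W, U_{4-j}⟩` if `j ≤ 4`, and `⟨W, U_j⟩` if `j ≥ 5`. -/
noncomputable def frenetTail (m : ℕ) (t : ℝ) : Tractor n :=
  let W := derived G x (m + 5) t
  let V := W
    - ∑ j : Fin 5, tractorMetric G (x t) W (frenetHead G x t (Fin.rev j)) • frenetHead G x t j
    - ∑ j : Fin m, tractorMetric G (x t) W (frenetTail j t) • frenetTail j t
  (√(tractorMetric G (x t) V V))⁻¹ • V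
termination_by m
decreasing_by all_goals exact j.2

/-- The tractor Frenet frame `U₀, U₁, …, U_{n+1}` (indices above `n + 1` carry no meaning). -/
noncomputable def frenet (i : ℕ) (t : ℝ) : Tractor n :=
  if h : i < 5 then frenetHead G x t ⟨i, h⟩ else frenetTail G x (i - 5) t

/-- The higher conformal curvature `Kᵢ = ⟨U'_{i+2}, U_{i+3}⟩`, for `3 ≤ i ≤ n - 2`, of a curve `x`
that is parametrized by a conformal pseudo-arc-length. -/
noncomputable def higherCurvature (i : ℕ) (s : ℝ) : ℝ :=
  tractorMetric G (x s) (tractorDeriv G x (frenet G x (i + 2)) s) (frenet G x (i + 3) s)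

end Coordinates

/-! ### Curves in a Lorentzian conformal manifold -/

section Curves

variable {n : ℕ} {M : Type*} [TopologicalSpace M] [ChartedSpace (EuclideanSpace ℝ (Fin n)) M]
  [IsManifold (𝓡 n) ∞ M]

/-- The components `g(∂ᵢ, ∂ⱼ)` of the metric `g` in the chart `φ`. -/
noncomputable def LorentzianMetric.inChart (g : LorentzianMetric n M)
    (φ : OpenPartialHomeomorph M (EuclideanSpace ℝ (Fin n))) (y : EuclideanSpace ℝ (Fin n)) :
    Matrix (Fin n) (Fin n) ℝ :=
  Matrix.of fun i j ↦ g.val (φ.symm y)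
    (mfderiv (𝓡 n) (𝓡 n) φ.symm y (EuclideanSpace.single i (1 : ℝ)))
    (mfderiv (𝓡 n) (𝓡 n) φ.symm y (EuclideanSpace.single j (1 : ℝ)))

variable (c : LorentzianConformalStructure n M) (γ : ℝ → M) (J : Set ℝ)

/-- A property `Q G x t` of curves in coordinates holds along `γ` on `J`: it holds at all `t ∈ J`,
in every scale and in every smooth chart around `γ t`. -/
def HoldsAlong (Q : (EuclideanSpace ℝ (Fin n) → Matrix (Fin n) (Fin n) ℝ) →
    (ℝ → EuclideanSpace ℝ (Fin n)) → ℝ → Prop) : Prop :=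
  ∀ g ∈ c.metrics, ∀ φ ∈ IsManifold.maximalAtlas (𝓡 n) ∞ M, ∀ t ∈ J, γ t ∈ φ.source →
    Q (g.inChart φ) (φ ∘ γ) t

/-- `γ` is a null curve on `J`. -/
def IsNullCurve : Prop := HoldsAlong c γ J IsNullAt

/-- `γ` is a generic curve on `J`. -/
def IsGenericCurve : Prop := HoldsAlong c γ J IsGenericAt

/-- `s` is a conformal pseudo-arc-length of `γ` on `J`: `ds = Δ₆(t)^(1/6) dt`. -/
def IsPseudoArcLength (s : ℝ → ℝ) : Prop :=
  HoldsAlong c γ J fun G x t ↦ HasDerivAt s (gramDet G x 6 t ^ (1 / 6 : ℝ)) t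

end Curves

end ConfCurve

/-! The tractor metric has index two and is preserved by the tractor connection. Differentiating the
relations between the first derived tractors shows that, in every parametrization, `T, …, U'''` span
a space of signature `(3, 2)` with `Δ₅ = 1`. What is orthogonal to it is positive definite, so the
Gram-Schmidt process continues with genuine square roots.

Let `V_k` be the part of `derived k` orthogonal to its predecessors. Then `Δ_{k+1} = Δ_k ⟨V_k, V_k⟩`
(`IsGramSchmidt.gram_succ`), and moving the derivative across the metric gives `K_i = |V_{i+3}| /
|V_{i+2}|`. Hence `K_i = √(Δ_{i+2} Δ_{i+4}) / Δ_{i+3}` when both sides are formed in the same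
parameter (`IsNullOn.higherCurvature_eq`).

It remains to change the parameter. Let `w = ds/dt`. The factor `u` is multiplied by `w⁻²`, so `T`
is multiplied by `w²`, and each `d/ds = w⁻¹ d/dt` contributes `w⁻¹`. Thus the `j`-th derived tractor
in `s` is `w^(2-j)` times the one in `t`, plus a combination of earlier ones
(`exists_derived_eq_sum`). The Gram determinants scale accordingly (`gramDet_eq`), and in the
quotient a single `w⁻¹` survives. The pseudo-arc-length enters only through `w = Δ₆^(1/6)`.
Everything takes place in a fixed scale and chart, near a given point. -/

namespace ConfCurve

/-! ### Gram determinants under triangular changes of a sequence. -/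

section GramDeterminants

variable {E : Type*} [AddCommGroup E] [Module ℝ E]

/-- The span of the first `j` vectors of the sequence `d`. -/
def flag (d : ℕ → E) (j : ℕ) : Submodule ℝ E := Submodule.span ℝ (d '' Set.Iio j)

theorem mem_flag (d : ℕ → E) {i j : ℕ} (h : i < j) : d i ∈ flag d j :=
  Submodule.subset_span ⟨i, h, rfl⟩

theorem flag_mono (d : ℕ → E) {i j : ℕ} (h : i ≤ j) : flag d i ≤ flag d j :=
  Submodule.span_mono (Set.image_mono (Set.Iio_subset_Iio h))

theorem flag_le {d : ℕ → E} {j : ℕ} {S : Submodule ℝ E} (h : ∀ i < j, d i ∈ S) : flag d j ≤ S := by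
  refine Submodule.span_le.2 ?_
  rintro _ ⟨i, hi, rfl⟩
  exact h i hi

theorem exists_of_mem_flag {d : ℕ → E} {j : ℕ} {v : E} (h : v ∈ flag d j) :
    ∃ c : ℕ → ℝ, v = ∑ l ∈ Finset.range j, c l • d l := by
  have : v ∈ Submodule.span ℝ (d '' (Finset.range j : Set ℕ)) := by
    convert h using 2
    simp only [flag, Finset.coe_range]
  obtain ⟨c, hc⟩ := (Submodule.mem_span_image_finset_iff_exists_fun' ℝ).1 this
  exact ⟨c, hc.symm⟩

variable (B : LinearMap.BilinForm ℝ E)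

/-- The Gram determinant of the first `m` vectors of the sequence `d`. -/
noncomputable def gram (d : ℕ → E) (m : ℕ) : ℝ :=
  (Matrix.of fun a b : Fin m ↦ B (d a) (d b)).det

theorem apply_eq_zero_of_mem_flag {d : ℕ → E} {j : ℕ} {v w : E} (hv : v ∈ flag d j)
    (h : ∀ i < j, B (d i) w = 0) : B v w = 0 := by
  have : flag d j ≤ LinearMap.ker (B.flip w) := flag_le fun i hi ↦ by simpa using h i hi
  simpa using this hv

/-- Writing `e = A d` with `A` lower triangular and diagonal `a`, the Gram matrix becomes `A * Gram
* Aᵀ`. -/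
theorem gram_triangular {d e : ℕ → E} {a : ℕ → ℝ} {m : ℕ}
    (h : ∀ j < m, e j - a j • d j ∈ flag d j) :
    gram B e m = (∏ j ∈ Finset.range m, a j) ^ 2 * gram B d m := by
  have h' : ∀ j : Fin m, ∃ c : ℕ → ℝ, e j - a j • d j = ∑ l ∈ Finset.range j, c l • d l :=
    fun j ↦ exists_of_mem_flag (h j j.2)
  choose c hc using h'
  set A : Matrix (Fin m) (Fin m) ℝ :=
    Matrix.of fun i j ↦ if j < i then c i j else if j = i then a i else 0 with hA
  have he : ∀ i : Fin m, e i = ∑ j : Fin m, A i j • d j := by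
    intro i
    have h1 : e i = (∑ l ∈ Finset.range i, c i l • d l) + a i • d i := by rw [← hc i]; abel
    have h2 : ∑ j : Fin m, A i j • d j = ∑ j ∈ Finset.range m,
        (if j < (i : ℕ) then c i j else if j = (i : ℕ) then a i else 0) • d j := by
      rw [← Fin.sum_univ_eq_sum_range
        (fun j ↦ (if j < (i : ℕ) then c i j else if j = (i : ℕ) then a i else 0) • d j)]
      simp [hA, Fin.ext_iff]
    rw [h1, h2, ← Finset.sum_subset (Finset.range_mono i.2), Finset.sum_range_succ]
    · congr 1
      · refine Finset.sum_congr rfl fun l hl ↦ ?_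
        rw [if_pos (Finset.mem_range.1 hl)]
      · simp
    · intro l _ hl
      have hl' : (i : ℕ) < l := by simpa using hl
      simp [hl'.not_gt, hl'.ne']
  have hM : (Matrix.of fun a b : Fin m ↦ B (e a) (e b))
      = A * (Matrix.of fun a b : Fin m ↦ B (d a) (d b)) * A.transpose := by
    ext i j
    simp only [Matrix.of_apply, Matrix.mul_apply, Matrix.transpose_apply, he, map_sum, map_smul,
      LinearMap.sum_apply, LinearMap.smul_apply, smul_eq_mul, Finset.sum_mul]
    refine Finset.sum_congr rfl fun k _ ↦ ?_
    rw [Finset.mul_sum]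
    refine Finset.sum_congr rfl fun l _ ↦ ?_
    ring
  have hdet : A.det = ∏ j ∈ Finset.range m, a j := by
    rw [Matrix.det_of_isLowerTriangular, ← Fin.prod_univ_eq_prod_range]
    · simp [hA]
    · intro i j hij
      have : i < j := hij
      simp [hA, this.not_gt, this.ne']
  rw [gram, hM, Matrix.det_mul, Matrix.det_mul, Matrix.det_transpose, hdet, gram]
  ring

/-- The last column has only its bottom entry, so Laplace expansion along it leaves one term. -/
theorem gram_succ_of_orthogonal {d : ℕ → E} {k : ℕ} (h : ∀ j < k, B (d j) (d k) = 0) :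
    gram B d (k + 1) = gram B d k * B (d k) (d k) := by
  rw [gram, Matrix.det_succ_column _ (Fin.last k), Fin.sum_univ_castSucc,
    Finset.sum_eq_zero fun i _ ↦ by simp [h], zero_add]
  have hsub : (Matrix.of fun a b : Fin (k + 1) ↦ B (d a) (d b)).submatrix
      (Fin.last k).succAbove (Fin.last k).succAbove =
      Matrix.of fun a b : Fin k ↦ B (d a) (d b) := by
    ext i j
    simp
  rw [hsub, (Even.add_self _).neg_one_pow]
  simp [gram, mul_comm]

theorem flag_le_flag_of_triangular {d e : ℕ → E} {m : ℕ}
    (h : ∀ j < m, ∃ a : ℝ, e j - a • d j ∈ flag d j) : flag e m ≤ flag d m := by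
  refine flag_le fun i hi ↦ ?_
  obtain ⟨a, ha⟩ := h i hi
  have := (flag d m).add_mem (flag_mono d hi.le ha) ((flag d m).smul_mem a (mem_flag d hi))
  simpa using this

theorem flag_eq_of_triangular {d e : ℕ → E} {m : ℕ}
    (h : ∀ j < m, ∃ a : ℝ, a ≠ 0 ∧ e j - a • d j ∈ flag d j) : flag e m = flag d m := by
  refine le_antisymm (flag_le_flag_of_triangular fun j hj ↦ (h j hj).imp fun _ h ↦ h.2) ?_
  induction m with
  | zero => exact flag_le fun i hi ↦ absurd hi i.not_lt_zero
  | succ m ih =>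
    have ih := ih fun j hj ↦ h j (by omega)
    refine flag_le fun i hi ↦ ?_
    rcases Nat.lt_succ_iff_lt_or_eq.1 hi with hi' | rfl
    · exact flag_mono e m.le_succ (ih (mem_flag d hi'))
    · obtain ⟨a, ha, hv⟩ := h i hi
      have h1 := flag_mono e i.le_succ (ih hv)
      have h2 := (flag e (i + 1)).smul_mem a⁻¹
        ((flag e (i + 1)).sub_mem (mem_flag e i.lt_succ_self) h1)
      simpa [smul_smul, inv_mul_cancel₀ ha] using h2

theorem notMem_flag_of_triangular {d e : ℕ → E} {m : ℕ}
    (h : ∀ j < m, ∃ a : ℝ, a ≠ 0 ∧ e j - a • d j ∈ flag d j) (hd : ∀ j < m, d j ∉ flag d j) :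
    ∀ j < m, e j ∉ flag e j := by
  intro j hj he
  rw [flag_eq_of_triangular fun i hi ↦ h i (hi.trans hj)] at he
  obtain ⟨a, ha, hv⟩ := h j hj
  have := (flag d j).smul_mem a⁻¹ ((flag d j).sub_mem he hv)
  exact hd j hj (by simpa [smul_smul, inv_mul_cancel₀ ha] using this)

/-- A bilinear form that is positive definite on the common kernel of two functionals is positive
on nonzero vectors orthogonal to a negative definite plane. -/
theorem pos_of_orthogonal_to_negative_plane (hB : ∀ v w, B v w = B w v) (l₁ l₂ : E →ₗ[ℝ] ℝ)
    (hl : ∀ v, v ≠ 0 → l₁ v = 0 → l₂ v = 0 → 0 < B v v) {p q v : E}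
    (hp : B p p < 0) (hq : B q q < 0) (hpq : B p q = 0) (hpv : B p v = 0) (hqv : B q v = 0)
    (hv : v ≠ 0) : 0 < B v v := by
  by_contra! hneg
  -- Two linear conditions on three coefficients: some nontrivial combination `w` of `p, q, v` lies
  -- in both kernels. If `B v v ≤ 0`, orthogonality makes `B w w ≤ 0`, which forces `w = 0`; then
  -- the negativity of `p` and `q` and `v ≠ 0` make all coefficients vanish.
  let f : (Fin 3 → ℝ) →ₗ[ℝ] (Fin 2 → ℝ) := LinearMap.pi
    ![l₁ ∘ₗ Fintype.linearCombination ℝ ![p, q, v], l₂ ∘ₗ Fintype.linearCombination ℝ ![p, q, v]]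
  have hker : LinearMap.ker f ≠ ⊥ := LinearMap.ker_ne_bot_of_finrank_lt (by simp)
  obtain ⟨c, hc, hc0⟩ := (Submodule.ne_bot_iff _).1 hker
  rw [LinearMap.mem_ker] at hc
  have h1 := congrFun hc 0
  have h2 := congrFun hc 1
  simp only [f, LinearMap.pi_apply, Matrix.cons_val_zero, Matrix.cons_val_one, LinearMap.comp_apply,
    Fintype.linearCombination_apply, Pi.zero_apply] at h1 h2
  set w := ∑ i, c i • (![p, q, v] : Fin 3 → E) i with hw
  have hww : B w w = c 0 ^ 2 * B p p + c 1 ^ 2 * B q q + c 2 ^ 2 * B v v := by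
    simp only [hw, Fin.sum_univ_three, Matrix.cons_val, map_add, map_smul, LinearMap.add_apply,
      LinearMap.smul_apply, smul_eq_mul, hpq, hpv, hqv, hB q p, hB v p, hB v q]
    ring
  have t0 : c 0 ^ 2 * B p p ≤ 0 := mul_nonpos_of_nonneg_of_nonpos (sq_nonneg _) hp.le
  have t1 : c 1 ^ 2 * B q q ≤ 0 := mul_nonpos_of_nonneg_of_nonpos (sq_nonneg _) hq.le
  have t2 : c 2 ^ 2 * B v v ≤ 0 := mul_nonpos_of_nonneg_of_nonpos (sq_nonneg _) hneg
  by_cases hw0 : w = 0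
  · have h0 : B w w = 0 := by simp [hw0]
    have e0 : c 0 = 0 := by
      have : c 0 ^ 2 * B p p = 0 := by linarith
      simpa [hp.ne] using this
    have e1 : c 1 = 0 := by
      have : c 1 ^ 2 * B q q = 0 := by linarith
      simpa [hq.ne] using this
    have e2 : c 2 = 0 := by
      have : c 2 • v = 0 := by simpa [hw, Fin.sum_univ_three, e0, e1] using hw0
      simpa [hv] using this
    refine hc0 (funext fun i ↦ ?_)
    fin_cases i <;> assumption
  · linarith [hl w hw0 h1 h2]

/-! ### Gram-Schmidt with a head of two hyperbolic pairs and a unit vector. -/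

/-- The index dual to `j` in a frame that starts with two hyperbolic pairs and a unit vector. -/
def dualIndex (j : ℕ) : ℕ := if j < 5 then 4 - j else j

theorem dualIndex_lt {j k : ℕ} (hk : 5 ≤ k) (hj : j < k) : dualIndex j < k := by
  unfold dualIndex; split_ifs <;> omega

theorem eq_dualIndex_comm {i j : ℕ} : i = dualIndex j ↔ dualIndex i = j := by
  unfold dualIndex; split_ifs <;> omega

/-- The component of `d k` orthogonal to the first `k` vectors of the frame `e`. -/
def orthogonalPart (d e : ℕ → E) (k : ℕ) : E :=
  d k - ∑ j ∈ Finset.range k, B (d k) (e (dualIndex j)) • e j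

/-- `e` results from the first `N` vectors of the sequence `d` by the Gram-Schmidt process, with
a head of two hyperbolic pairs and a unit vector. -/
structure IsGramSchmidt (d e : ℕ → E) (N : ℕ) : Prop where
  symm : ∀ v w, B v w = B w v
  index : ∃ l₁ l₂ : E →ₗ[ℝ] ℝ, ∀ v, v ≠ 0 → l₁ v = 0 → l₂ v = 0 → 0 < B v v
  notMem_flag : ∀ j < N, d j ∉ flag d j
  -- A sign has to be allowed because `U₃` starts with `-U''`.
  head_flag : ∀ j < 5, ∃ a : ℝ, a ^ 2 = 1 ∧ e j - a • d j ∈ flag d j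
  head_apply : ∀ i < 5, ∀ j < 5, B (e i) (e j) = if i = dualIndex j then 1 else 0
  tail : ∀ k, 5 ≤ k → k < N → e k =
    (√(B (orthogonalPart B d e k) (orthogonalPart B d e k)))⁻¹ • orthogonalPart B d e k

namespace IsGramSchmidt

variable {B} {d e : ℕ → E} {N : ℕ} (h : IsGramSchmidt B d e N)
include h

theorem pos {v : E} (hv : v ≠ 0) (he : ∀ i < 5, B (e i) v = 0) : 0 < B v v := by
  obtain ⟨l₁, l₂, hl⟩ := h.index
  -- Each hyperbolic pair contributes one negative direction, of square `-2`.
  refine pos_of_orthogonal_to_negative_plane B h.symm l₁ l₂ hl (p := e 0 - e 4) (q := e 1 - e 3)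
    ?_ ?_ ?_ ?_ ?_ hv
  all_goals simp [h.head_apply, he, dualIndex]

/-- Pairing the orthogonal part with `e i` leaves only the summand at `dualIndex i`, which cancels
`B (e i) (d k)`. The orthogonal part is nonzero since `d k` is not in the span of its predecessors,
so its square is positive by `pos`. -/
theorem step {k : ℕ} (hk : 5 ≤ k) (hkN : k < N)
    (hflag : ∀ j < k, ∃ a : ℝ, a ≠ 0 ∧ e j - a • d j ∈ flag d j)
    (happ : ∀ i < k, ∀ j < k, B (e i) (e j) = if i = dualIndex j then 1 else 0) :
    orthogonalPart B d e k - d k ∈ flag d k ∧ (∀ i < k, B (e i) (orthogonalPart B d e k) = 0) ∧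
      0 < B (orthogonalPart B d e k) (orthogonalPart B d e k) := by
  have h1 : orthogonalPart B d e k - d k ∈ flag d k := by
    rw [orthogonalPart, sub_sub_cancel_left, ← flag_eq_of_triangular hflag]
    exact neg_mem (sum_mem fun j hj ↦ Submodule.smul_mem _ _ (mem_flag e (Finset.mem_range.1 hj)))
  have h2 : ∀ i < k, B (e i) (orthogonalPart B d e k) = 0 := by
    intro i hi
    rw [orthogonalPart, map_sub, map_sum, Finset.sum_eq_single (dualIndex i)]
    · rw [map_smul, happ i hi _ (dualIndex_lt hk hi), if_pos (eq_dualIndex_comm.2 rfl),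
        ← eq_dualIndex_comm.2 (rfl : dualIndex i = _), h.symm]
      simp
    · intro j hj hne
      rw [map_smul, happ i hi j (Finset.mem_range.1 hj), if_neg, smul_zero]
      intro hij
      exact hne (eq_dualIndex_comm.1 hij).symm
    · intro hi'
      exact absurd (Finset.mem_range.2 (dualIndex_lt hk hi)) hi'
  refine ⟨h1, h2, h.pos ?_ fun i hi ↦ h2 i (by omega)⟩
  intro h0
  rw [h0, zero_sub] at h1
  exact h.notMem_flag k hkN (by simpa using h1)

theorem frame : ∀ k, 5 ≤ k → k ≤ N →
    (∀ j < k, ∃ a : ℝ, a ≠ 0 ∧ e j - a • d j ∈ flag d j) ∧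
      ∀ i < k, ∀ j < k, B (e i) (e j) = if i = dualIndex j then 1 else 0 := by
  intro k hk
  induction k, hk using Nat.le_induction with
  | base =>
    refine fun _ ↦ ⟨fun j hj ↦ ?_, h.head_apply⟩
    obtain ⟨a, ha, hv⟩ := h.head_flag j hj
    exact ⟨a, by rintro rfl; norm_num at ha, hv⟩
  | succ k hk ih =>
    intro hkN
    obtain ⟨hf, ha⟩ := ih (by omega)
    obtain ⟨h1, h2, h3⟩ := h.step hk (by omega) hf ha
    have hq := Real.sqrt_pos.2 h3
    have he := h.tail k hk (by omega)
    have hek : ∀ i < k, B (e i) (e k) = 0 := fun i hi ↦ by rw [he, map_smul, h2 i hi, smul_zero]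
    have hkk : k = dualIndex k := by simp [dualIndex, hk.not_gt]
    refine ⟨fun j hj ↦ ?_, fun i hi j hj ↦ ?_⟩
    · rcases Nat.lt_succ_iff_lt_or_eq.1 hj with hj | rfl
      · exact hf j hj
      · refine ⟨_, (inv_pos.2 hq).ne', ?_⟩
        nth_rw 1 [he]
        rw [← smul_sub]
        exact Submodule.smul_mem _ _ h1
    · rcases Nat.lt_succ_iff_lt_or_eq.1 hi with hi | rfl <;>
        rcases Nat.lt_succ_iff_lt_or_eq.1 hj with hj | rfl
      · exact ha i hi j hj
      · rw [hek i hi, if_neg (by omega)]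
      · rw [h.symm, hek j hj, if_neg]
        have := dualIndex_lt hk hj
        omega
      · rw [if_pos hkk, he]
        simp only [map_smul, LinearMap.smul_apply, smul_eq_mul]
        field_simp
        exact (Real.sq_sqrt h3.le).symm

variable {k : ℕ} (hk : 5 ≤ k) (hkN : k < N)
include hk hkN

theorem orthogonalPart_pos : 0 < B (orthogonalPart B d e k) (orthogonalPart B d e k) :=
  let hf := h.frame k hk hkN.le
  (h.step hk hkN hf.1 hf.2).2.2

theorem orthogonalPart_sub_mem : orthogonalPart B d e k - d k ∈ flag d k :=
  let hf := h.frame k hk hkN.le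
  (h.step hk hkN hf.1 hf.2).1

theorem apply_orthogonalPart {v : E} (hv : v ∈ flag d k) : B v (orthogonalPart B d e k) = 0 := by
  have hf := h.frame k hk hkN.le
  rw [← flag_eq_of_triangular hf.1] at hv
  exact apply_eq_zero_of_mem_flag B hv (h.step hk hkN hf.1 hf.2).2.1

theorem apply_frame {v : E} (hv : v ∈ flag d k) : B v (e k) = 0 := by
  rw [h.tail k hk hkN, map_smul, h.apply_orthogonalPart hk hkN hv, smul_zero]

/-- The orthogonal part `V` differs from `d k` by a vector orthogonal to `V`, so `B (d k) V = B V
V`. -/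
theorem apply_self : B (d k) (e k) =
    √(B (orthogonalPart B d e k) (orthogonalPart B d e k)) := by
  have h1 := h.apply_orthogonalPart hk hkN (h.orthogonalPart_sub_mem hk hkN)
  rw [map_sub, LinearMap.sub_apply, sub_eq_zero] at h1
  rw [h.tail k hk hkN, map_smul, ← h1, smul_eq_mul]
  have hq := h.orthogonalPart_pos hk hkN
  have := Real.sqrt_pos.2 hq
  field_simp
  exact (Real.sq_sqrt hq.le).symm

theorem frame_sub_mem : e k - (√(B (orthogonalPart B d e k) (orthogonalPart B d e k)))⁻¹ • d k
    ∈ flag d k := by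
  nth_rw 1 [h.tail k hk hkN]
  rw [← smul_sub]
  exact Submodule.smul_mem _ _ (h.orthogonalPart_sub_mem hk hkN)

/-- Replacing `d k` by its orthogonal part is a unipotent triangular change, which keeps the
determinant and makes the last column trivial. -/
theorem gram_succ :
    gram B d (k + 1) = gram B d k * B (orthogonalPart B d e k) (orthogonalPart B d e k) := by
  set f : ℕ → E := Function.update d k (orthogonalPart B d e k) with hf
  have hfd : ∀ j < k, f j = d j := fun j hj ↦ by simp [hf, hj.ne]
  have hfk : f k = orthogonalPart B d e k := by simp [hf]
  have h1 : gram B f (k + 1) = gram B d (k + 1) := by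
    rw [gram_triangular B (d := d) (a := fun _ ↦ 1)]
    · simp
    · intro j hj
      rcases Nat.lt_succ_iff_lt_or_eq.1 hj with hj | rfl
      · simp [hfd j hj]
      · simpa [hfk] using h.orthogonalPart_sub_mem hk hkN
  have h2 : gram B f k = gram B d k := by
    unfold gram
    congr 1
    ext i j
    simp [hfd]
  rw [← h1, gram_succ_of_orthogonal, h2, hfk]
  intro j hj
  rw [hfd j hj, hfk]
  exact h.apply_orthogonalPart hk hkN (mem_flag d hj)

omit hk hkN

/-- The head is a triangular change of `d` with diagonal entries `±1`, and its Gram matrix is the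
antidiagonal one, of determinant `1` because reversing five letters is an even permutation. This
starts the induction for `gram_pos`. -/
theorem gram_five : gram B d 5 = 1 := by
  have h' : ∀ j, ∃ a : ℝ, j < 5 → a ^ 2 = 1 ∧ e j - a • d j ∈ flag d j := by
    intro j
    by_cases hj : j < 5
    · exact (h.head_flag j hj).imp fun _ h _ ↦ h
    · exact ⟨0, fun h ↦ absurd h hj⟩
  choose a ha using h'
  have h1 := gram_triangular B (m := 5) fun j hj ↦ (ha j hj).2
  rw [← Finset.prod_pow, Finset.prod_eq_one fun j hj ↦ (ha j (Finset.mem_range.1 hj)).1,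
    one_mul] at h1
  rw [← h1, gram]
  have : (Matrix.of fun a b : Fin 5 ↦ B (e a) (e b)) = !![0, 0, 0, 0, 1; 0, 0, 0, 1, 0;
      0, 0, 1, 0, 0; 0, 1, 0, 0, 0; 1, 0, 0, 0, 0] := by
    ext i j
    rw [Matrix.of_apply, h.head_apply _ i.2 _ j.2]
    fin_cases i <;> fin_cases j <;> simp [dualIndex]
  rw [this]
  simp [Matrix.det_succ_row_zero, Fin.sum_univ_succ, Fin.succAbove]
  norm_num

theorem gram_pos {k : ℕ} (hk : 5 ≤ k) (hkN : k ≤ N) : 0 < gram B d k := by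
  induction k, hk using Nat.le_induction with
  | base => simp [h.gram_five]
  | succ k hk ih =>
    rw [h.gram_succ hk (by omega)]
    exact mul_pos (ih (by omega)) (h.orthogonalPart_pos hk (by omega))

end IsGramSchmidt

end GramDeterminants

/-! ### The Levi-Civita and tractor connections in a chart: smoothness and compatibility with the
metrics. -/

section Coordinates

variable {n : ℕ}

/-- A smooth field `G` of symmetric invertible matrices on the open set `Ω`, positive definite on
a hyperplane at every point. -/
structure IsMetricOn (G : EuclideanSpace ℝ (Fin n) → Matrix (Fin n) (Fin n) ℝ)
    (Ω : Set (EuclideanSpace ℝ (Fin n))) : Prop where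
  isOpen : IsOpen Ω
  contDiffOn : ∀ i j, ContDiffOn ℝ ∞ (fun y ↦ G y i j) Ω
  symm : ∀ y ∈ Ω, ∀ i j, G y i j = G y j i
  det_ne_zero : ∀ y ∈ Ω, (G y).det ≠ 0
  index : ∀ y ∈ Ω, ∃ l : EuclideanSpace ℝ (Fin n) →ₗ[ℝ] ℝ,
    ∀ v, v ≠ 0 → l v = 0 → 0 < metricAt G y v v

variable {G : EuclideanSpace ℝ (Fin n) → Matrix (Fin n) (Fin n) ℝ}
  {Ω : Set (EuclideanSpace ℝ (Fin n))}

theorem contDiffOn_pderiv (hΩ : IsOpen Ω) {f : EuclideanSpace ℝ (Fin n) → ℝ}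
    (hf : ContDiffOn ℝ ∞ f Ω) (i : Fin n) : ContDiffOn ℝ ∞ (pderiv i f) Ω :=
  (hf.fderiv_of_isOpen hΩ (by simp)).clm_apply contDiffOn_const

theorem contDiffOn_det {X : Type*} [NormedAddCommGroup X] [NormedSpace ℝ X] {S : Set X} {m : ℕ}
    {A : X → Matrix (Fin m) (Fin m) ℝ}
    (h : ∀ i j, ContDiffOn ℝ ∞ (fun y ↦ A y i j) S) : ContDiffOn ℝ ∞ (fun y ↦ (A y).det) S := by
  simp only [Matrix.det_apply]
  exact ContDiffOn.sum fun σ _ ↦ (contDiffOn_prod fun i _ ↦ h _ _).const_smul _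

namespace IsMetricOn

variable (hG : IsMetricOn G Ω)
include hG

theorem contDiffOn_inv (i j : Fin n) : ContDiffOn ℝ ∞ (fun y ↦ (G y)⁻¹ i j) Ω := by
  simp only [Matrix.inv_def, Matrix.smul_apply, Ring.inverse_eq_inv', smul_eq_mul,
    Matrix.adjugate_apply]
  refine ((contDiffOn_det hG.contDiffOn).inv hG.det_ne_zero).mul (contDiffOn_det fun k l ↦ ?_)
  by_cases hk : k = j
  · simpa [Matrix.updateRow_apply, hk] using contDiffOn_const
  · simpa [Matrix.updateRow_apply, hk] using hG.contDiffOn k l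

theorem contDiffOn_christoffel (k i j : Fin n) :
    ContDiffOn ℝ ∞ (fun y ↦ christoffel G y k i j) Ω :=
  contDiffOn_const.mul <| ContDiffOn.sum fun l _ ↦ (hG.contDiffOn_inv k l).mul <|
    ((contDiffOn_pderiv hG.isOpen (hG.contDiffOn j l) i).add
      (contDiffOn_pderiv hG.isOpen (hG.contDiffOn i l) j)).sub
      (contDiffOn_pderiv hG.isOpen (hG.contDiffOn i j) l)

theorem contDiffOn_ricci (i j : Fin n) : ContDiffOn ℝ ∞ (fun y ↦ ricci G y i j) Ω :=
  ContDiffOn.sum fun k _ ↦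
    ((contDiffOn_pderiv hG.isOpen (hG.contDiffOn_christoffel k i j) k).sub
      (contDiffOn_pderiv hG.isOpen (hG.contDiffOn_christoffel k i k) j)).add <|
    ContDiffOn.sum fun l _ ↦
      ((hG.contDiffOn_christoffel k k l).mul (hG.contDiffOn_christoffel l i j)).sub
        ((hG.contDiffOn_christoffel k j l).mul (hG.contDiffOn_christoffel l i k))

theorem contDiffOn_scalarCurvature : ContDiffOn ℝ ∞ (scalarCurvature G) Ω :=
  ContDiffOn.sum fun i _ ↦ ContDiffOn.sum fun j _ ↦
    (hG.contDiffOn_inv i j).mul (hG.contDiffOn_ricci i j)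

theorem contDiffOn_schouten (i j : Fin n) : ContDiffOn ℝ ∞ (fun y ↦ schouten G y i j) Ω :=
  contDiffOn_const.mul <| (hG.contDiffOn_ricci i j).sub <|
    (hG.contDiffOn_scalarCurvature.div_const _).mul (hG.contDiffOn i j)

theorem sum_mul_inv {y : EuclideanSpace ℝ (Fin n)} (hy : y ∈ Ω) (i j : Fin n) :
    ∑ k, G y i k * (G y)⁻¹ k j = if i = j then 1 else 0 := by
  rw [← Matrix.mul_apply, Matrix.mul_nonsing_inv _ (hG.det_ne_zero y hy).isUnit, Matrix.one_apply]

/-- The Levi-Civita connection is metric. -/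
theorem sum_christoffel {y : EuclideanSpace ℝ (Fin n)} (hy : y ∈ Ω) (i j k : Fin n) :
    pderiv i (fun z ↦ G z j k) y =
      ∑ l, G y l k * christoffel G y l i j + ∑ l, G y j l * christoffel G y l i k := by
  -- Lowering the upper index cancels `G⁻¹` and leaves Koszul's formula. In the sum of its two
  -- instances only the derivative of `G j k` survives.
  have key : ∀ a b c : Fin n, ∑ l, G y c l * christoffel G y l a b =
      1 / 2 * (pderiv a (fun z ↦ G z b c) y + pderiv b (fun z ↦ G z a c) y
        - pderiv c (fun z ↦ G z a b) y) := by
    intro a b c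
    calc ∑ l, G y c l * christoffel G y l a b
        = ∑ m, 1 / 2 * (∑ l, G y c l * (G y)⁻¹ l m) * (pderiv a (fun z ↦ G z b m) y
          + pderiv b (fun z ↦ G z a m) y - pderiv m (fun z ↦ G z a b) y) := by
          simp only [christoffel, Finset.mul_sum, Finset.sum_mul]
          rw [Finset.sum_comm]
          refine Finset.sum_congr rfl fun m _ ↦ Finset.sum_congr rfl fun l _ ↦ ?_
          ring
      _ = _ := by simp [hG.sum_mul_inv hy]
  have hsym : ∀ a b c, pderiv a (fun z ↦ G z b c) y = pderiv a (fun z ↦ G z c b) y := by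
    intro a b c
    have : (fun z ↦ G z b c) =ᶠ[nhds y] fun z ↦ G z c b := by
      filter_upwards [hG.isOpen.mem_nhds hy] with z hz using hG.symm z hz b c
    rw [pderiv, pderiv, this.fderiv_eq]
  simp only [hG.symm y hy _ k]
  rw [key, key, hsym i k j]
  ring

end IsMetricOn

theorem metricAt_eq_dotProduct (y v w : EuclideanSpace ℝ (Fin n)) :
    metricAt G y v w = ⇑v ⬝ᵥ (G y).mulVec ⇑w := by
  simp only [metricAt, dotProduct, Matrix.mulVec, Finset.mul_sum]
  refine Finset.sum_congr rfl fun i _ ↦ Finset.sum_congr rfl fun j _ ↦ ?_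
  ring

/-- The matrix of the connection form along the curve `x`. -/
noncomputable def connectionMatrix (G : EuclideanSpace ℝ (Fin n) → Matrix (Fin n) (Fin n) ℝ)
    (x : ℝ → EuclideanSpace ℝ (Fin n)) (t : ℝ) : Matrix (Fin n) (Fin n) ℝ :=
  Matrix.of fun k j ↦ ∑ i, christoffel G (x t) k i j * (deriv x t) i

theorem covDeriv_apply (x v : ℝ → EuclideanSpace ℝ (Fin n)) (t : ℝ) (k : Fin n) :
    covDeriv G x v t k =
      deriv (fun τ ↦ v τ k) t + (connectionMatrix G x t).mulVec (⇑(v t)) k := by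
  simp only [covDeriv, connectionMatrix, Matrix.mulVec, dotProduct, Matrix.of_apply, Finset.sum_mul]
  rw [Finset.sum_comm]

theorem fderiv_eq_sum_pderiv (f : EuclideanSpace ℝ (Fin n) → ℝ) (y u : EuclideanSpace ℝ (Fin n)) :
    fderiv ℝ f y u = ∑ i, pderiv i f y * u i := by
  have hu : u = ∑ i, u i • EuclideanSpace.single i (1 : ℝ) := by
    ext j
    simp [Pi.single_apply]
  conv_lhs => rw [hu]
  simp [pderiv, mul_comm]

theorem differentiableAt_coord {v : ℝ → EuclideanSpace ℝ (Fin n)} {t : ℝ}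
    (hv : DifferentiableAt ℝ v t) (k : Fin n) : DifferentiableAt ℝ (fun τ ↦ v τ k) t :=
  differentiableAt_euclidean.1 hv k

namespace IsMetricOn

variable (hG : IsMetricOn G Ω) {x : ℝ → EuclideanSpace ℝ (Fin n)} {t : ℝ}
  (hx : DifferentiableAt ℝ x t) (ht : x t ∈ Ω)
include hG hx ht

/-- With `A` the connection matrix, `G' = Aᵀ G + G A` is metric compatibility restricted to the
curve. It is what the terms `A v` of the covariant derivative compensate. -/
theorem hasDerivAt_metric (i j : Fin n) : HasDerivAt (fun τ ↦ G (x τ) i j)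
    (((connectionMatrix G x t).transpose * G (x t) + G (x t) * connectionMatrix G x t) i j) t := by
  have h1 : DifferentiableAt ℝ (fun y ↦ G y i j) (x t) :=
    ((hG.contDiffOn i j).contDiffAt (hG.isOpen.mem_nhds ht)).differentiableAt (by simp)
  refine (h1.hasFDerivAt.comp_hasDerivAt t hx.hasDerivAt).congr_deriv ?_
  rw [fderiv_eq_sum_pderiv]
  simp only [hG.sum_christoffel ht, Matrix.add_apply, Matrix.mul_apply, Matrix.transpose_apply,
    connectionMatrix, Matrix.of_apply, add_mul, Finset.sum_add_distrib, Finset.sum_mul,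
    Finset.mul_sum]
  congr 1 <;>
  · rw [Finset.sum_comm]
    refine Finset.sum_congr rfl fun k _ ↦ Finset.sum_congr rfl fun l _ ↦ ?_
    ring

theorem hasDerivAt_metricAt {v w : ℝ → EuclideanSpace ℝ (Fin n)} (hv : DifferentiableAt ℝ v t)
    (hw : DifferentiableAt ℝ w t) :
    HasDerivAt (fun τ ↦ metricAt G (x τ) (v τ) (w τ))
      (metricAt G (x t) (covDeriv G x v t) (w t) + metricAt G (x t) (v t) (covDeriv G x w t)) t := by
  have h1 : HasDerivAt (fun τ ↦ metricAt G (x τ) (v τ) (w τ))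
      (∑ i, ∑ j, ((((connectionMatrix G x t).transpose * G (x t)
        + G (x t) * connectionMatrix G x t) i j * v t i
          + G (x t) i j * deriv (fun τ ↦ v τ i) t) * w t j
          + G (x t) i j * v t i * deriv (fun τ ↦ w τ j) t)) t :=
    HasDerivAt.fun_sum fun i _ ↦ HasDerivAt.fun_sum fun j _ ↦
      ((hG.hasDerivAt_metric hx ht i j).mul (differentiableAt_coord hv i).hasDerivAt).mul
        (differentiableAt_coord hw j).hasDerivAt
  refine h1.congr_deriv ?_
  have hcov : ∀ u : ℝ → EuclideanSpace ℝ (Fin n), ⇑(covDeriv G x u t) =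
      (fun k ↦ deriv (fun τ ↦ u τ k) t) + (connectionMatrix G x t).mulVec ⇑(u t) := fun u ↦
    funext fun k ↦ covDeriv_apply x u t k
  have e1 : ∀ (A : Matrix (Fin n) (Fin n) ℝ) (a b : Fin n → ℝ),
      ∑ i, ∑ j, A i j * a i * b j = a ⬝ᵥ A.mulVec b := fun A a b ↦ by
    simp only [dotProduct, Matrix.mulVec, Finset.mul_sum]
    refine Finset.sum_congr rfl fun i _ ↦ Finset.sum_congr rfl fun j _ ↦ ?_
    ring
  simp only [metricAt_eq_dotProduct, hcov, add_mul, Finset.sum_add_distrib, e1, Matrix.mulVec_add,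
    dotProduct_add, add_dotProduct, Matrix.add_mulVec, ← Matrix.mulVec_mulVec,
    Matrix.mulVec_transpose]
  have e2 : ∀ (A : Matrix (Fin n) (Fin n) ℝ) (a b : Fin n → ℝ),
      a ⬝ᵥ Matrix.vecMul b A = A.mulVec a ⬝ᵥ b := fun A a b ↦ by
    rw [dotProduct_comm, ← Matrix.dotProduct_mulVec, dotProduct_comm]
  rw [e2]
  ring

end IsMetricOn

/-- The tractor metric as a bilinear form. -/
noncomputable def tractorForm (G : EuclideanSpace ℝ (Fin n) → Matrix (Fin n) (Fin n) ℝ)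
    (y : EuclideanSpace ℝ (Fin n)) : LinearMap.BilinForm ℝ (Tractor n) :=
  LinearMap.mk₂ ℝ (tractorMetric G y)
    (fun V V' W ↦ by
      simp [tractorMetric, metricAt_eq_dotProduct, add_dotProduct]; ring)
    (fun c V W ↦ by
      simp [tractorMetric, metricAt_eq_dotProduct]; ring)
    (fun V W W' ↦ by
      simp [tractorMetric, metricAt_eq_dotProduct, Matrix.mulVec_add]; ring)
    (fun c V W ↦ by
      simp [tractorMetric, metricAt_eq_dotProduct, Matrix.mulVec_smul]; ring)

theorem tractorForm_apply (y : EuclideanSpace ℝ (Fin n)) (V W : Tractor n) :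
    tractorForm G y V W = tractorMetric G y V W := rfl

theorem gramDet_eq_gram (x : ℝ → EuclideanSpace ℝ (Fin n)) (i : ℕ) (t : ℝ) :
    gramDet G x i t = gram (tractorForm G (x t)) (fun j ↦ derived G x j t) i := rfl

namespace IsMetricOn

variable (hG : IsMetricOn G Ω)
include hG

theorem metricAt_comm {y : EuclideanSpace ℝ (Fin n)} (hy : y ∈ Ω) (v w : EuclideanSpace ℝ (Fin n)) :
    metricAt G y v w = metricAt G y w v := by
  rw [metricAt, Finset.sum_comm, metricAt]
  refine Finset.sum_congr rfl fun i _ ↦ Finset.sum_congr rfl fun j _ ↦ ?_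
  rw [hG.symm y hy j i]
  ring

theorem tractorMetric_comm {y : EuclideanSpace ℝ (Fin n)} (hy : y ∈ Ω) (V W : Tractor n) :
    tractorMetric G y V W = tractorMetric G y W V := by
  rw [tractorMetric, tractorMetric, hG.metricAt_comm hy]
  ring

theorem metricAt_schouten {y : EuclideanSpace ℝ (Fin n)} (hy : y ∈ Ω)
    (u w : EuclideanSpace ℝ (Fin n)) :
    metricAt G y w (WithLp.toLp 2 (fun b ↦ ∑ c, (G y)⁻¹ b c * ∑ a, schouten G y a c * u a)) =
      ∑ a, ∑ c, schouten G y a c * u a * w c := by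
  have h1 : (WithLp.toLp 2 (fun b ↦ ∑ c, (G y)⁻¹ b c * ∑ a, schouten G y a c * u a) :
      EuclideanSpace ℝ (Fin n)) =
      WithLp.toLp 2 ((G y)⁻¹.mulVec fun c ↦ ∑ a, schouten G y a c * u a) := rfl
  rw [h1, metricAt_eq_dotProduct, WithLp.ofLp_toLp, Matrix.mulVec_mulVec,
    Matrix.mul_nonsing_inv _ (hG.det_ne_zero y hy).isUnit, Matrix.one_mulVec, dotProduct,
    Finset.sum_comm]
  refine Finset.sum_congr rfl fun c _ ↦ ?_
  rw [Finset.mul_sum]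
  refine Finset.sum_congr rfl fun a _ ↦ ?_
  ring

/-- The product rule for the Levi-Civita connection gives the main terms. The algebraic terms of the
tractor connection cancel in pairs: `-⟨U, μ⟩` in the first slot against `ρ U` in the middle one, and
the Schouten term of the middle slot against that of the last. -/
theorem hasDerivAt_tractorMetric {x : ℝ → EuclideanSpace ℝ (Fin n)} {t : ℝ}
    (hx : DifferentiableAt ℝ x t) (ht : x t ∈ Ω) {V W : ℝ → Tractor n}
    (hV : DifferentiableAt ℝ V t) (hW : DifferentiableAt ℝ W t) :
    HasDerivAt (fun τ ↦ tractorMetric G (x τ) (V τ) (W τ))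
      (tractorMetric G (x t) (tractorDeriv G x V t) (W t)
        + tractorMetric G (x t) (V t) (tractorDeriv G x W t)) t := by
  have h1 := ((hG.hasDerivAt_metricAt hx ht hV.snd.fst hW.snd.fst).add
    (hV.fst.hasDerivAt.mul hW.snd.snd.hasDerivAt)).add
    (hV.snd.snd.hasDerivAt.mul hW.fst.hasDerivAt)
  refine h1.congr_deriv ?_
  have hadd : ∀ a b c, metricAt G (x t) c (a + b) = metricAt G (x t) c a + metricAt G (x t) c b :=
    fun a b c ↦ by simp [metricAt_eq_dotProduct, Matrix.mulVec_add]
  have hsmul : ∀ (r : ℝ) a c, metricAt G (x t) c (r • a) = r * metricAt G (x t) c a :=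
    fun r a c ↦ by simp [metricAt_eq_dotProduct, Matrix.mulVec_smul]
  simp only [tractorMetric, tractorDeriv]
  rw [hG.metricAt_comm ht (_ + _ + _) (W t).2.1]
  simp only [hadd, hsmul, hG.metricAt_schouten ht]
  rw [hG.metricAt_comm ht (deriv x t) (W t).2.1, hG.metricAt_comm ht (deriv x t) (V t).2.1,
    hG.metricAt_comm ht (W t).2.1 (covDeriv G x (fun τ ↦ (V τ).2.1) t)]
  ring

end IsMetricOn

end Coordinates

/-! ### The derived sequence and the Frenet frame along a null curve. -/

section NullCurves

variable {n : ℕ} {G : EuclideanSpace ℝ (Fin n) → Matrix (Fin n) (Fin n) ℝ}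
  {Ω : Set (EuclideanSpace ℝ (Fin n))} {x : ℝ → EuclideanSpace ℝ (Fin n)} {I : Set ℝ}

theorem tractorDeriv_add {V W : ℝ → Tractor n} {t : ℝ}
    (hV : DifferentiableAt ℝ V t) (hW : DifferentiableAt ℝ W t) :
    tractorDeriv G x (fun τ ↦ V τ + W τ) t = tractorDeriv G x V t + tractorDeriv G x W t := by
  have h1 := deriv_fun_add hV.fst hW.fst
  have h2 := deriv_fun_add hV.snd.snd hW.snd.snd
  have h3 : ∀ k, deriv (fun τ ↦ (V τ).2.1 k + (W τ).2.1 k) t =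
      deriv (fun τ ↦ (V τ).2.1 k) t + deriv (fun τ ↦ (W τ).2.1 k) t := fun k ↦
    deriv_fun_add (differentiableAt_coord hV.snd.fst k) (differentiableAt_coord hW.snd.fst k)
  refine Prod.ext ?_ (Prod.ext ?_ ?_)
  · simp only [tractorDeriv, Prod.fst_add, Prod.snd_add, h1, metricAt_eq_dotProduct,
      WithLp.ofLp_add, Matrix.mulVec_add, dotProduct_add]
    ring
  · ext k
    simp only [tractorDeriv, Prod.fst_add, Prod.snd_add, PiLp.add_apply, PiLp.smul_apply,
      smul_eq_mul, covDeriv_apply, h3, WithLp.ofLp_add, Matrix.mulVec_add, Pi.add_apply]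
    ring
  · simp only [tractorDeriv, Prod.snd_add, Prod.fst_add, h2, PiLp.add_apply, mul_add,
      Finset.sum_add_distrib]
    ring

theorem covDeriv_smul {f : ℝ → ℝ} {v : ℝ → EuclideanSpace ℝ (Fin n)} {t : ℝ}
    (hf : DifferentiableAt ℝ f t) (hv : DifferentiableAt ℝ v t) :
    covDeriv G x (fun τ ↦ f τ • v τ) t = deriv f t • v t + f t • covDeriv G x v t := by
  ext k
  have h3 : deriv (fun τ ↦ f τ * v τ k) t = deriv f t * v t k + f t * deriv (fun τ ↦ v τ k) t :=
    deriv_fun_mul hf (differentiableAt_coord hv k)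
  simp only [covDeriv_apply, PiLp.add_apply, PiLp.smul_apply, smul_eq_mul, h3, WithLp.ofLp_smul,
    Matrix.mulVec_smul, Pi.smul_apply]
  ring

theorem tractorDeriv_smul {f : ℝ → ℝ} {V : ℝ → Tractor n} {t : ℝ}
    (hf : DifferentiableAt ℝ f t) (hV : DifferentiableAt ℝ V t) :
    tractorDeriv G x (fun τ ↦ f τ • V τ) t = deriv f t • V t + f t • tractorDeriv G x V t := by
  have h1 := deriv_fun_mul hf hV.fst
  have h2 := deriv_fun_mul hf hV.snd.snd
  have h3 := covDeriv_smul (G := G) (x := x) hf hV.snd.fst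
  refine Prod.ext ?_ (Prod.ext ?_ ?_)
  · simp only [tractorDeriv, Prod.smul_fst, Prod.smul_snd, Prod.fst_add, smul_eq_mul, h1,
      metricAt_eq_dotProduct, WithLp.ofLp_smul, Matrix.mulVec_smul, dotProduct_smul]
    ring
  · simp only [tractorDeriv, Prod.smul_fst, Prod.smul_snd, Prod.fst_add, Prod.snd_add, h3]
    module
  · simp only [tractorDeriv, Prod.smul_snd, Prod.smul_fst, Prod.snd_add, smul_eq_mul, h2,
      PiLp.smul_apply, mul_sub, Finset.mul_sum]
    rw [add_sub_assoc]
    congr 2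
    refine Finset.sum_congr rfl fun a _ ↦ Finset.sum_congr rfl fun c _ ↦ ?_
    ring

theorem derived_one (t : ℝ) : derived G x 1 t =
    (0, (√(metricAt G (x t) (acceleration G x t) (acceleration G x t)))⁻¹ • deriv x t,
      deriv (fun τ ↦ (√(metricAt G (x τ) (acceleration G x τ) (acceleration G x τ)))⁻¹) t) := by
  refine Prod.ext ?_ (Prod.ext ?_ ?_)
  · simp [derived, tractorDeriv, metricAt]
  · have : covDeriv G x (fun _ ↦ 0) t = 0 := by
      ext k
      simp [covDeriv]
    simp [derived, tractorDeriv, this]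
  · simp [derived, tractorDeriv]

/-- A smooth null curve `x`, parametrized by `I`, in the domain of a metric. -/
structure IsNullOn (G : EuclideanSpace ℝ (Fin n) → Matrix (Fin n) (Fin n) ℝ)
    (Ω : Set (EuclideanSpace ℝ (Fin n))) (x : ℝ → EuclideanSpace ℝ (Fin n)) (I : Set ℝ) : Prop where
  metric : IsMetricOn G Ω
  isOpen : IsOpen I
  contDiffOn : ContDiffOn ℝ ∞ x I
  mapsTo : Set.MapsTo x I Ω
  null : ∀ t ∈ I, metricAt G (x t) (deriv x t) (deriv x t) = 0
  acceleration_pos : ∀ t ∈ I, 0 < metricAt G (x t) (acceleration G x t) (acceleration G x t)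

namespace IsNullOn

variable (h : IsNullOn G Ω x I)
include h

theorem contDiffOn_deriv {F : Type*} [NormedAddCommGroup F] [NormedSpace ℝ F] {f : ℝ → F}
    (hf : ContDiffOn ℝ ∞ f I) : ContDiffOn ℝ ∞ (deriv f) I :=
  hf.deriv_of_isOpen h.isOpen (by simp)

theorem differentiableAt {F : Type*} [NormedAddCommGroup F] [NormedSpace ℝ F] {f : ℝ → F}
    (hf : ContDiffOn ℝ ∞ f I) {t : ℝ} (ht : t ∈ I) : DifferentiableAt ℝ f t :=
  (hf.contDiffAt (h.isOpen.mem_nhds ht)).differentiableAt (by simp)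

theorem contDiffOn_metricAt {v w : ℝ → EuclideanSpace ℝ (Fin n)} (hv : ContDiffOn ℝ ∞ v I)
    (hw : ContDiffOn ℝ ∞ w I) : ContDiffOn ℝ ∞ (fun t ↦ metricAt G (x t) (v t) (w t)) I :=
  ContDiffOn.sum fun i _ ↦ ContDiffOn.sum fun j _ ↦
    (((h.metric.contDiffOn i j).comp h.contDiffOn h.mapsTo).mul (contDiffOn_euclidean.1 hv i)).mul
      (contDiffOn_euclidean.1 hw j)

theorem contDiffOn_covDeriv {v : ℝ → EuclideanSpace ℝ (Fin n)} (hv : ContDiffOn ℝ ∞ v I) :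
    ContDiffOn ℝ ∞ (covDeriv G x v) I :=
  contDiffOn_euclidean.2 fun k ↦ (h.contDiffOn_deriv (contDiffOn_euclidean.1 hv k)).add <|
    ContDiffOn.sum fun i _ ↦ ContDiffOn.sum fun j _ ↦
      (((h.metric.contDiffOn_christoffel k i j).comp h.contDiffOn h.mapsTo).mul
        (contDiffOn_euclidean.1 (h.contDiffOn_deriv h.contDiffOn) i)).mul
        (contDiffOn_euclidean.1 hv j)

theorem contDiffOn_tractorMetric {V W : ℝ → Tractor n} (hV : ContDiffOn ℝ ∞ V I)
    (hW : ContDiffOn ℝ ∞ W I) : ContDiffOn ℝ ∞ (fun t ↦ tractorMetric G (x t) (V t) (W t)) I :=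
  ((h.contDiffOn_metricAt hV.snd.fst hW.snd.fst).add (hV.fst.mul hW.snd.snd)).add
    (hV.snd.snd.mul hW.fst)

theorem contDiffOn_tractorDeriv {V : ℝ → Tractor n} (hV : ContDiffOn ℝ ∞ V I) :
    ContDiffOn ℝ ∞ (tractorDeriv G x V) I := by
  have hU := h.contDiffOn_deriv h.contDiffOn
  have hP : ∀ a c, ContDiffOn ℝ ∞ (fun t ↦ schouten G (x t) a c * (deriv x t) a) I := fun a c ↦
    ((h.metric.contDiffOn_schouten a c).comp h.contDiffOn h.mapsTo).mul (contDiffOn_euclidean.1 hU a)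
  refine ((h.contDiffOn_deriv hV.fst).sub (h.contDiffOn_metricAt hU hV.snd.fst)).prodMk
    (ContDiffOn.prodMk ?_ ?_)
  · refine ((h.contDiffOn_covDeriv hV.snd.fst).add (hV.snd.snd.smul hU)).add (hV.fst.smul ?_)
    refine contDiffOn_euclidean.2 fun b ↦ ?_
    change ContDiffOn ℝ ∞
      (fun t ↦ ∑ c, (G (x t))⁻¹ b c * ∑ a, schouten G (x t) a c * (deriv x t) a) I
    exact ContDiffOn.sum fun c _ ↦ ((h.metric.contDiffOn_inv b c).comp h.contDiffOn h.mapsTo).mul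
        (ContDiffOn.sum fun a _ ↦ hP a c)
  · exact (h.contDiffOn_deriv hV.snd.snd).sub <| ContDiffOn.sum fun a _ ↦ ContDiffOn.sum fun c _ ↦
      (hP a c).mul (contDiffOn_euclidean.1 hV.snd.fst c)

theorem contDiffOn_acceleration : ContDiffOn ℝ ∞ (acceleration G x) I :=
  h.contDiffOn_covDeriv (h.contDiffOn_deriv h.contDiffOn)

theorem contDiffOn_scale : ContDiffOn ℝ ∞
    (fun t ↦ (√(metricAt G (x t) (acceleration G x t) (acceleration G x t)))⁻¹) I :=
  ((h.contDiffOn_metricAt h.contDiffOn_acceleration h.contDiffOn_acceleration).sqrt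
    fun t ht ↦ (h.acceleration_pos t ht).ne').inv
    fun t ht ↦ (Real.sqrt_pos.2 (h.acceleration_pos t ht)).ne'

theorem contDiffOn_derived (j : ℕ) : ContDiffOn ℝ ∞ (derived G x j) I := by
  induction j with
  | zero => exact contDiffOn_const.prodMk (contDiffOn_const.prodMk h.contDiffOn_scale)
  | succ j ih => exact h.contDiffOn_tractorDeriv ih

theorem contDiffOn_gramDet (i : ℕ) : ContDiffOn ℝ ∞ (gramDet G x i) I :=
  contDiffOn_det fun a b ↦
    h.contDiffOn_tractorMetric (h.contDiffOn_derived a) (h.contDiffOn_derived b)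

theorem hasDerivAt_tractorMetric {V W : ℝ → Tractor n} (hV : ContDiffOn ℝ ∞ V I)
    (hW : ContDiffOn ℝ ∞ W I) {t : ℝ} (ht : t ∈ I) :
    HasDerivAt (fun τ ↦ tractorMetric G (x τ) (V τ) (W τ))
      (tractorMetric G (x t) (tractorDeriv G x V t) (W t)
        + tractorMetric G (x t) (V t) (tractorDeriv G x W t)) t :=
  h.metric.hasDerivAt_tractorMetric (h.differentiableAt h.contDiffOn ht) (h.mapsTo ht)
    (h.differentiableAt hV ht) (h.differentiableAt hW ht)

theorem tractorMetric_comm {t : ℝ} (ht : t ∈ I) (V W : Tractor n) :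
    tractorMetric G (x t) V W = tractorMetric G (x t) W V :=
  h.metric.tractorMetric_comm (h.mapsTo ht) V W

/-- If `⟨V, W⟩` is constant, then `⟨V', W⟩ = -⟨V, W'⟩`. -/
theorem tractorMetric_tractorDeriv_of_const {V W : ℝ → Tractor n} (hV : ContDiffOn ℝ ∞ V I)
    (hW : ContDiffOn ℝ ∞ W I) {c : ℝ} (hc : ∀ t ∈ I, tractorMetric G (x t) (V t) (W t) = c) {t : ℝ}
    (ht : t ∈ I) : tractorMetric G (x t) (V t) (tractorDeriv G x W t) =
      -tractorMetric G (x t) (tractorDeriv G x V t) (W t) := by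
  have h1 := h.hasDerivAt_tractorMetric hV hW ht
  have h2 : HasDerivAt (fun τ ↦ tractorMetric G (x τ) (V τ) (W τ)) 0 t :=
    (hasDerivAt_const t c).congr_of_eventuallyEq
      (Filter.eventuallyEq_of_mem (h.isOpen.mem_nhds ht) hc)
  linarith [h1.unique h2]

theorem metricAt_acceleration {t : ℝ} (ht : t ∈ I) :
    metricAt G (x t) (deriv x t) (acceleration G x t) = 0 := by
  have hU := h.differentiableAt (h.contDiffOn_deriv h.contDiffOn) ht
  have h1 := h.metric.hasDerivAt_metricAt (h.differentiableAt h.contDiffOn ht) (h.mapsTo ht) hU hU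
  have h2 : HasDerivAt (fun τ ↦ metricAt G (x τ) (deriv x τ) (deriv x τ)) 0 t :=
    (hasDerivAt_const t 0).congr_of_eventuallyEq
      (Filter.eventuallyEq_of_mem (h.isOpen.mem_nhds ht) h.null)
  have h3 := h1.unique h2
  rw [h.metric.metricAt_comm (h.mapsTo ht)] at h3
  simp only [acceleration]
  linarith

theorem derived_two {t : ℝ} (ht : t ∈ I) : (derived G x 2 t).1 = 0 ∧ (derived G x 2 t).2.1 =
    (√(metricAt G (x t) (acceleration G x t) (acceleration G x t)))⁻¹ • acceleration G x t +
      (2 * deriv (fun τ ↦ (√(metricAt G (x τ) (acceleration G x τ) (acceleration G x τ)))⁻¹) t)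
        • deriv x t := by
  have h1 : derived G x 1 = _ := funext derived_one
  have h2 := covDeriv_smul (G := G) (x := x) (h.differentiableAt h.contDiffOn_scale ht)
    (h.differentiableAt (h.contDiffOn_deriv h.contDiffOn) ht)
  rw [derived, h1]
  refine ⟨?_, ?_⟩
  · have := h.null t ht
    simp only [metricAt_eq_dotProduct] at this
    simp [tractorDeriv, metricAt_eq_dotProduct, Matrix.mulVec_smul, this]
  · simp only [tractorDeriv]
    rw [h2]
    simp only [acceleration]
    module

/-- The middle slot of `derived 2` is `u⁻¹ U'` plus a multiple of `U`. Since `U` is null and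
orthogonal to `U'`, the normalization of `T` by `u⁻¹` makes this tractor a unit vector, in any
parametrization. -/
theorem derived_apply {t : ℝ} (ht : t ∈ I) :
    (tractorMetric G (x t) (derived G x 0 t) (derived G x 0 t) = 0 ∧
      tractorMetric G (x t) (derived G x 0 t) (derived G x 1 t) = 0 ∧
      tractorMetric G (x t) (derived G x 0 t) (derived G x 2 t) = 0) ∧
      tractorMetric G (x t) (derived G x 1 t) (derived G x 1 t) = 0 ∧
      tractorMetric G (x t) (derived G x 2 t) (derived G x 2 t) = 1 := by
  have h0 : derived G x 0 t = (0, 0, _) := rfl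
  have hn := h.null t ht
  have hua := h.metricAt_acceleration ht
  have hau := hua
  rw [h.metric.metricAt_comm (h.mapsTo ht)] at hau
  have hp := h.acceleration_pos t ht
  refine ⟨⟨?_, ?_, ?_⟩, ?_, ?_⟩
  · simp [h0, tractorMetric, metricAt]
  · simp [h0, derived_one, tractorMetric, metricAt]
  · simp [h0, (h.derived_two ht).1, tractorMetric, metricAt]
  · simp only [metricAt_eq_dotProduct] at hn
    simp [derived_one, tractorMetric, metricAt_eq_dotProduct, Matrix.mulVec_smul, hn]
  · rw [tractorMetric, (h.derived_two ht).1, (h.derived_two ht).2]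
    set u := √(metricAt G (x t) (acceleration G x t) (acceleration G x t)) with hu
    have hu2 : u ^ 2 = metricAt G (x t) (acceleration G x t) (acceleration G x t) :=
      Real.sq_sqrt hp.le
    have hu0 : u ≠ 0 := (Real.sqrt_pos.2 hp).ne'
    clear_value u
    simp only [metricAt_eq_dotProduct] at *
    simp only [WithLp.ofLp_add, WithLp.ofLp_smul, Matrix.mulVec_add, Matrix.mulVec_smul,
      dotProduct_add, add_dotProduct, smul_dotProduct, dotProduct_smul, smul_eq_mul, hn, hua, hau,
      ← hu2]
    field_simp
    ring

theorem derived_apply' {t : ℝ} (ht : t ∈ I) :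
    (tractorMetric G (x t) (derived G x 1 t) (derived G x 2 t) = 0 ∧
      tractorMetric G (x t) (derived G x 0 t) (derived G x 3 t) = 0 ∧
      tractorMetric G (x t) (derived G x 1 t) (derived G x 3 t) = -1 ∧
      tractorMetric G (x t) (derived G x 2 t) (derived G x 3 t) = 0) ∧
    (tractorMetric G (x t) (derived G x 0 t) (derived G x 4 t) = 1 ∧
      tractorMetric G (x t) (derived G x 1 t) (derived G x 4 t) = 0 ∧
      tractorMetric G (x t) (derived G x 2 t) (derived G x 4 t) = -alpha G x t ∧
      tractorMetric G (x t) (derived G x 3 t) (derived G x 4 t) = deriv (alpha G x) t / 2) := by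
  -- Every further product comes from differentiating one already known to be constant.
  have key : ∀ {i j : ℕ} {c : ℝ},
      (∀ t ∈ I, tractorMetric G (x t) (derived G x i t) (derived G x j t) = c) → ∀ t ∈ I,
      tractorMetric G (x t) (derived G x i t) (derived G x (j + 1) t) =
        -tractorMetric G (x t) (derived G x (i + 1) t) (derived G x j t) := fun hc t ht ↦
    h.tractorMetric_tractorDeriv_of_const (h.contDiffOn_derived _) (h.contDiffOn_derived _) hc ht
  have diag : ∀ {i : ℕ} {c : ℝ},
      (∀ t ∈ I, tractorMetric G (x t) (derived G x i t) (derived G x i t) = c) → ∀ t ∈ I,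
      tractorMetric G (x t) (derived G x i t) (derived G x (i + 1) t) = 0 := fun hc t ht ↦ by
    have := key hc t ht
    rw [h.tractorMetric_comm ht (derived G x (_ + 1) t)] at this
    linarith
  have h12 := diag fun t ht ↦ (h.derived_apply ht).2.1
  have h23 := diag fun t ht ↦ (h.derived_apply ht).2.2
  have h03 : ∀ t ∈ I, tractorMetric G (x t) (derived G x 0 t) (derived G x 3 t) = 0 :=
    fun t ht ↦ by rw [key (fun t ht ↦ (h.derived_apply ht).1.2.2) t ht, h12 t ht, neg_zero]
  have h13 : ∀ t ∈ I, tractorMetric G (x t) (derived G x 1 t) (derived G x 3 t) = -1 :=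
    fun t ht ↦ by rw [key h12 t ht, (h.derived_apply ht).2.2]
  refine ⟨⟨h12 t ht, h03 t ht, h13 t ht, h23 t ht⟩, ?_, ?_, ?_, ?_⟩
  · rw [key h03 t ht, h13 t ht, neg_neg]
  · rw [key h13 t ht, h23 t ht, neg_zero]
  · rw [key h23 t ht, alpha]
  · have h1 : deriv (alpha G x) t = _ :=
      (h.hasDerivAt_tractorMetric (h.contDiffOn_derived 3) (h.contDiffOn_derived 3) ht).deriv
    rw [h1, h.tractorMetric_comm ht (tractorDeriv G x _ t)]
    simp only [derived]
    ring

/-- The coefficients of the head are made for this: `½ α` in `U₃` kills `⟨U₃, U₃⟩`; in `U₄`, `α`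
kills `⟨U₂, U₄⟩`, `½ α'` kills `⟨U₃, U₄⟩`, and `½ (α² - β)` kills `⟨U₄, U₄⟩`. -/
theorem frenetHead_apply {t : ℝ} (ht : t ∈ I) (i j : ℕ) (hi : i < 5) (hj : j < 5) :
    tractorMetric G (x t) (frenet G x i t) (frenet G x j t) =
      if i = dualIndex j then 1 else 0 := by
  obtain ⟨⟨h00, h01, h02⟩, h11, h22⟩ := h.derived_apply ht
  obtain ⟨⟨h12, h03, h13, h23⟩, h04, h14, h24, h34⟩ := h.derived_apply' ht
  have h33 : tractorMetric G (x t) (derived G x 3 t) (derived G x 3 t) = alpha G x t := rfl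
  have h44 : tractorMetric G (x t) (derived G x 4 t) (derived G x 4 t) = beta G x t := rfl
  have hs := h.tractorMetric_comm ht
  have h10 := (hs _ _).trans h01
  have h20 := (hs _ _).trans h02
  have h30 := (hs _ _).trans h03
  have h40 := (hs _ _).trans h04
  have h21 := (hs _ _).trans h12
  have h31 := (hs _ _).trans h13
  have h41 := (hs _ _).trans h14
  have h32 := (hs _ _).trans h23
  have h42 := (hs _ _).trans h24
  have h43 := (hs _ _).trans h34
  simp only [← tractorForm_apply] at *
  interval_cases i <;> interval_cases j <;>
    simp only [frenet, frenetHead, dualIndex] <;> simp [*] <;> ring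

end IsNullOn

/-- One functional restricts `μ` to a hyperplane where `G` is positive definite. The other imposes
`σ = ρ`, which turns the hyperbolic term `2 σ ρ` into `2 σ²`. -/
theorem IsMetricOn.tractor_index (hG : IsMetricOn G Ω) {y : EuclideanSpace ℝ (Fin n)} (hy : y ∈ Ω) :
    ∃ l₁ l₂ : Tractor n →ₗ[ℝ] ℝ, ∀ V, V ≠ 0 → l₁ V = 0 → l₂ V = 0 → 0 < tractorForm G y V V := by
  obtain ⟨l, hl⟩ := hG.index y hy
  refine ⟨l ∘ₗ LinearMap.fst ℝ _ ℝ ∘ₗ LinearMap.snd ℝ ℝ _,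
    LinearMap.fst ℝ ℝ _ - LinearMap.snd ℝ _ ℝ ∘ₗ LinearMap.snd ℝ ℝ _, ?_⟩
  rintro ⟨σ, μ, ρ⟩ hV h1 h2
  simp only [LinearMap.coe_comp, Function.comp_apply, LinearMap.snd_apply, LinearMap.fst_apply,
    LinearMap.sub_apply, sub_eq_zero] at h1 h2
  subst h2
  rw [tractorForm_apply, tractorMetric]
  rcases eq_or_ne μ 0 with rfl | hμ
  · have hσ : σ ≠ 0 := by
      rintro rfl
      exact hV rfl
    have : metricAt G y 0 0 = 0 := by simp [metricAt]
    linarith [mul_self_pos.2 hσ]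
  · linarith [hl μ hμ h1, mul_self_nonneg σ]

theorem frenet_of_lt {i : ℕ} (h : i < 5) (t : ℝ) : frenet G x i t = frenetHead G x t ⟨i, h⟩ :=
  dif_pos h

theorem frenet_add_five (m : ℕ) (t : ℝ) : frenet G x (5 + m) t = frenetTail G x m t := by
  rw [frenet, dif_neg (by omega), Nat.add_sub_cancel_left]

/-- Splitting the sum at index `5` matches the two sums in `frenetTail`: on the head `dualIndex` is
`Fin.rev`, on the tail it is the identity. -/
theorem orthogonalPart_derived (m : ℕ) (t : ℝ) :
    orthogonalPart (tractorForm G (x t)) (fun j ↦ derived G x j t) (fun j ↦ frenet G x j t)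
      (5 + m) = derived G x (m + 5) t
        - ∑ j : Fin 5, tractorMetric G (x t) (derived G x (m + 5) t)
            (frenetHead G x t (Fin.rev j)) • frenetHead G x t j
        - ∑ j : Fin m, tractorMetric G (x t) (derived G x (m + 5) t)
            (frenetTail G x j t) • frenetTail G x j t := by
  have h1 : ∑ j : Fin 5, tractorMetric G (x t) (derived G x (m + 5) t)
      (frenetHead G x t (Fin.rev j)) • frenetHead G x t j = ∑ j : Fin 5,
        tractorMetric G (x t) (derived G x (m + 5) t) (frenet G x (dualIndex j) t) •
          frenet G x j t := by
    refine Finset.sum_congr rfl fun j _ ↦ ?_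
    have hj : dualIndex j = (Fin.rev j : ℕ) := by
      rw [dualIndex, if_pos j.2, Fin.val_rev]
      omega
    rw [hj, frenet_of_lt j.2, frenet_of_lt (Fin.rev j).2]
  have h2 : ∀ j, dualIndex (5 + j) = 5 + j := fun j ↦ by simp [dualIndex]
  rw [orthogonalPart, Finset.sum_range_add, h1, ← sub_sub, add_comm 5 m,
    ← Fin.sum_univ_eq_sum_range (fun j ↦ tractorForm G (x t) (derived G x (m + 5) t)
      (frenet G x (dualIndex j) t) • frenet G x j t),
    ← Fin.sum_univ_eq_sum_range (fun j ↦ tractorForm G (x t) (derived G x (m + 5) t)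
      (frenet G x (dualIndex (5 + j)) t) • frenet G x (5 + j) t)]
  simp only [h2, frenet_add_five, tractorForm_apply]

theorem frenetTail_eq (m : ℕ) (t : ℝ) :
    frenet G x (5 + m) t = (√(tractorForm G (x t)
      (orthogonalPart (tractorForm G (x t)) (fun j ↦ derived G x j t)
        (fun j ↦ frenet G x j t) (5 + m))
      (orthogonalPart (tractorForm G (x t)) (fun j ↦ derived G x j t)
        (fun j ↦ frenet G x j t) (5 + m))))⁻¹ •
      orthogonalPart (tractorForm G (x t)) (fun j ↦ derived G x j t)
        (fun j ↦ frenet G x j t) (5 + m) := by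
  rw [orthogonalPart_derived, frenet_add_five, frenetTail]
  rfl

theorem notMem_flag_of_isGenericAt {t : ℝ} (h : IsGenericAt G x t) :
    ∀ j < n + 2, derived G x j t ∉ flag (fun j ↦ derived G x j t) j := by
  intro j hj hmem
  have h1 : (⟨j, hj⟩ : Fin (n + 2)) ∉ Set.Iio (⟨j, hj⟩ : Fin (n + 2)) := by simp
  refine h.notMem_span_image h1 ?_
  have h2 : (fun i : Fin (n + 2) ↦ derived G x i t) '' Set.Iio ⟨j, hj⟩ =
      (fun i ↦ derived G x i t) '' Set.Iio j := by
    ext v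
    constructor
    · rintro ⟨i, hi, rfl⟩
      exact ⟨i, hi, rfl⟩
    · rintro ⟨i, hi, rfl⟩
      exact ⟨⟨i, lt_trans hi hj⟩, hi, rfl⟩
  rw [h2]
  exact hmem

/-- For a nonpositive square the conventions `√r = 0` and `0⁻¹ = 0` would make `T` vanish, against
linear independence. -/
theorem acceleration_pos_of_isGenericAt {t : ℝ} (h : IsGenericAt G x t) :
    0 < metricAt G (x t) (acceleration G x t) (acceleration G x t) := by
  by_contra! hneg
  have h0 := h.ne_zero 0
  simp [derived, Real.sqrt_eq_zero_of_nonpos hneg] at h0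

namespace IsNullOn

variable (h : IsNullOn G Ω x I)
include h

theorem isGramSchmidt {N : ℕ} {t : ℝ} (ht : t ∈ I)
    (hgen : ∀ j < N, derived G x j t ∉ flag (fun j ↦ derived G x j t) j) :
    IsGramSchmidt (tractorForm G (x t)) (fun j ↦ derived G x j t) (fun j ↦ frenet G x j t) N where
  symm := h.tractorMetric_comm ht
  index := h.metric.tractor_index (h.mapsTo ht)
  notMem_flag := hgen
  head_flag j hj := by
    have hm : ∀ {i k : ℕ}, i < k →
        derived G x i t ∈ flag (fun j ↦ derived G x j t) k := fun hik ↦ mem_flag _ hik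
    interval_cases j
    · exact ⟨1, by norm_num, by simp [frenet, frenetHead]⟩
    · exact ⟨1, by norm_num, by simp [frenet, frenetHead]⟩
    · exact ⟨1, by norm_num, by simp [frenet, frenetHead]⟩
    · have e : frenet G x 3 t =
          -derived G x 3 t - (1 / 2 * alpha G x t) • derived G x 1 t := rfl
      refine ⟨-1, by norm_num, ?_⟩
      have := Submodule.smul_mem _ (-(1 / 2 * alpha G x t)) (hm (by norm_num : 1 < 3))
      convert this using 1
      simp only [e]
      module
    · have e : frenet G x 4 t = derived G x 4 t + alpha G x t • derived G x 2 t
          + (1 / 2 * deriv (alpha G x) t) • derived G x 1 t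
          + (1 / 2 * (alpha G x t ^ 2 - beta G x t)) • derived G x 0 t := rfl
      refine ⟨1, by norm_num, ?_⟩
      have := add_mem (add_mem
        (Submodule.smul_mem _ (alpha G x t) (hm (by norm_num : 2 < 4)))
        (Submodule.smul_mem _ (1 / 2 * deriv (alpha G x) t) (hm (by norm_num : 1 < 4))))
        (Submodule.smul_mem _ (1 / 2 * (alpha G x t ^ 2 - beta G x t)) (hm (by norm_num : 0 < 4)))
      convert this using 1
      simp only [e]
      module
  head_apply i hi j hj := h.frenetHead_apply ht i j hi hj
  tail k hk _ := by
    obtain ⟨m, rfl⟩ := Nat.exists_eq_add_of_le hk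
    exact frenetTail_eq m t

variable {N : ℕ} (hgen : ∀ t ∈ I, ∀ j < N, derived G x j t ∉ flag (fun j ↦ derived G x j t) j)
include hgen

/-- The tail is built recursively from earlier members, and the positivity of `⟨V_k, V_k⟩` keeps the
square root and its inverse smooth. -/
theorem contDiffOn_frenet {k : ℕ} (hk : k < N) : ContDiffOn ℝ ∞ (frenet G x k) I := by
  have hd := h.contDiffOn_derived
  have hα : ContDiffOn ℝ ∞ (alpha G x) I := h.contDiffOn_tractorMetric (hd 3) (hd 3)
  have hβ : ContDiffOn ℝ ∞ (beta G x) I := h.contDiffOn_tractorMetric (hd 4) (hd 4)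
  have head : ∀ i < 5, ContDiffOn ℝ ∞ (frenet G x i) I := by
    intro i hi
    have hfun : frenet G x i = fun t ↦ frenetHead G x t ⟨i, hi⟩ := funext (frenet_of_lt hi)
    rw [hfun]
    interval_cases i
    · exact hd 0
    · exact hd 1
    · exact hd 2
    · exact (hd 3).neg.sub ((contDiffOn_const.mul hα).smul (hd 1))
    · exact (((hd 4).add (hα.smul (hd 2))).add
        ((contDiffOn_const.mul (h.contDiffOn_deriv hα)).smul (hd 1))).add
        ((contDiffOn_const.mul ((hα.pow 2).sub hβ)).smul (hd 0))
  induction k using Nat.strong_induction_on with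
  | _ k ih =>
    rcases lt_or_ge k 5 with hk5 | hk5
    · exact head k hk5
    obtain ⟨m, rfl⟩ := Nat.exists_eq_add_of_le hk5
    have hV : ContDiffOn ℝ ∞ (fun t ↦ orthogonalPart (tractorForm G (x t))
        (fun j ↦ derived G x j t) (fun j ↦ frenet G x j t) (5 + m)) I :=
      (hd _).sub <| ContDiffOn.sum fun j hj ↦ by
        have hj := Finset.mem_range.1 hj
        have hj' := dualIndex_lt hk5 hj
        exact (h.contDiffOn_tractorMetric (hd _) (ih _ hj' (hj'.trans hk))).smul
          (ih j hj (hj.trans hk))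
    have hpos := fun t ht ↦ (h.isGramSchmidt ht (hgen t ht)).orthogonalPart_pos hk5 hk
    rw [funext (frenetTail_eq m)]
    exact (((h.contDiffOn_tractorMetric hV hV).sqrt fun t ht ↦ (hpos t ht).ne').inv
      fun t ht ↦ (Real.sqrt_pos.2 (hpos t ht)).ne').smul hV

/-- The higher conformal curvatures in terms of Gram determinants of the same parametrization. -/
theorem higherCurvature_eq {i : ℕ} (hi : 3 ≤ i) (hiN : i + 3 < N) {t : ℝ} (ht : t ∈ I) :
    higherCurvature G x i t = √(gramDet G x (i + 2) t * gramDet G x (i + 4) t) /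
      gramDet G x (i + 3) t := by
  have hGS := fun t ht ↦ h.isGramSchmidt ht (hgen t ht)
  set V : ℕ → ℝ := fun k ↦ tractorForm G (x t)
    (orthogonalPart (tractorForm G (x t)) (fun j ↦ derived G x j t) (fun j ↦ frenet G x j t) k)
    (orthogonalPart (tractorForm G (x t)) (fun j ↦ derived G x j t) (fun j ↦ frenet G x j t) k)
  -- The derivative is moved from `U_{i+2}` onto `U_{i+3}`, there `U_{i+2}` is replaced by its
  -- leading term `|V_{i+2}|⁻¹ • derived (i + 2)`, and the derivative is moved back to give `derived
  -- (i + 3)`. No coefficient is ever differentiated.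
  have hK : higherCurvature G x i t = (√(V (i + 2)))⁻¹ * √(V (i + 3)) := by
    have horth : ∀ τ ∈ I, ∀ j < i + 3,
        tractorMetric G (x τ) (derived G x j τ) (frenet G x (i + 3) τ) = 0 := fun τ hτ j hj ↦
      (hGS τ hτ).apply_frame (by omega) hiN (mem_flag (fun j ↦ derived G x j τ) hj)
    have hd' : ∀ j < i + 3, tractorMetric G (x t) (derived G x j t)
        (tractorDeriv G x (frenet G x (i + 3)) t) =
        -tractorMetric G (x t) (derived G x (j + 1) t) (frenet G x (i + 3) t) := fun j hj ↦
      h.tractorMetric_tractorDeriv_of_const (h.contDiffOn_derived j)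
        (h.contDiffOn_frenet hgen hiN) (fun τ hτ ↦ horth τ hτ j hj) ht
    have h1 := h.tractorMetric_tractorDeriv_of_const
      (h.contDiffOn_frenet hgen (show i + 2 < N by omega)) (h.contDiffOn_frenet hgen hiN)
      (c := 0) (fun τ hτ ↦ (hGS τ hτ).apply_frame (by omega) hiN (by
        have hf := ((hGS τ hτ).frame (i + 3) (by omega) hiN.le).1
        rw [← flag_eq_of_triangular hf]
        exact mem_flag (fun j ↦ frenet G x j τ) (by omega))) ht
    -- The lower terms of `U_{i+2}` drop out: for `j < i + 2`, the derivative `derived (j + 1)` is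
    -- still orthogonal to `U_{i+3}`.
    have h2 := apply_eq_zero_of_mem_flag (tractorForm G (x t))
      (w := tractorDeriv G x (frenet G x (i + 3)) t)
      ((hGS t ht).frame_sub_mem (k := i + 2) (by omega) (by omega)) (fun j hj ↦ by
        rw [tractorForm_apply, hd' j (by omega), horth t ht _ (by omega), neg_zero])
    have h3 := (hGS t ht).apply_self (k := i + 3) (by omega) hiN
    rw [map_sub, map_smul, LinearMap.sub_apply, LinearMap.smul_apply, sub_eq_zero] at h2
    change tractorMetric G (x t) (frenet G x (i + 2) t) _ =
      (√(V (i + 2)))⁻¹ * tractorMetric G (x t) (derived G x (i + 2) t) _ at h2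
    change tractorMetric G (x t) (derived G x (i + 3) t) _ = √(V (i + 3)) at h3
    rw [hd' _ (by omega), h1, mul_neg, neg_inj, h3] at h2
    exact h2
  have e1 := (hGS t ht).gram_succ (k := i + 2) (by omega) (by omega)
  have e2 := (hGS t ht).gram_succ (k := i + 3) (by omega) (by omega)
  have p0 := (hGS t ht).gram_pos (k := i + 2) (by omega) (by omega)
  have p1 := (hGS t ht).orthogonalPart_pos (k := i + 2) (by omega) (by omega)
  have p2 := (hGS t ht).orthogonalPart_pos (k := i + 3) (by omega) (by omega)
  rw [hK, gramDet_eq_gram, gramDet_eq_gram, gramDet_eq_gram, e2, e1]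
  change 0 < V (i + 2) at p1
  change 0 < V (i + 3) at p2
  change _ = √(_ * (_ * V (i + 2) * V (i + 3))) / (_ * V (i + 2))
  set g := gram (tractorForm G (x t)) (fun j ↦ derived G x j t) (i + 2)
  have hg : g * (g * V (i + 2) * V (i + 3)) = g ^ 2 * (V (i + 2) * V (i + 3)) := by ring
  rw [hg, Real.sqrt_mul (sq_nonneg g), Real.sqrt_sq p0.le, Real.sqrt_mul p1.le,
    mul_div_mul_left _ _ p0.ne']
  have q1 := Real.sqrt_pos.2 p1
  field_simp
  rw [Real.sq_sqrt p1.le]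

end IsNullOn

/-! ### Change of parameter. -/

theorem covDeriv_congr {v w : ℝ → EuclideanSpace ℝ (Fin n)} {t : ℝ} (h : v =ᶠ[nhds t] w) :
    covDeriv G x v t = covDeriv G x w t := by
  ext k
  have h1 : (fun τ ↦ v τ k) =ᶠ[nhds t] fun τ ↦ w τ k := by
    filter_upwards [h] with τ hτ using by rw [hτ]
  rw [covDeriv_apply, covDeriv_apply, h1.deriv_eq, h.self_of_nhds]

theorem tractorDeriv_congr {V W : ℝ → Tractor n} {t : ℝ} (h : V =ᶠ[nhds t] W) :
    tractorDeriv G x V t = tractorDeriv G x W t := by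
  have h1 : (fun τ ↦ (V τ).1) =ᶠ[nhds t] fun τ ↦ (W τ).1 := h.fun_comp Prod.fst
  have h2 : (fun τ ↦ (V τ).2.1) =ᶠ[nhds t] fun τ ↦ (W τ).2.1 := h.fun_comp fun p ↦ p.2.1
  have h3 : (fun τ ↦ (V τ).2.2) =ᶠ[nhds t] fun τ ↦ (W τ).2.2 := h.fun_comp fun p ↦ p.2.2
  rw [tractorDeriv, tractorDeriv, covDeriv_congr h2, h1.deriv_eq, h3.deriv_eq, h.self_of_nhds]

theorem tractorDeriv_sum_smul {c : ℕ → ℝ → ℝ} {V : ℕ → ℝ → Tractor n} {t : ℝ}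
    (hc : ∀ l, DifferentiableAt ℝ (c l) t) (hV : ∀ l, DifferentiableAt ℝ (V l) t) (m : ℕ) :
    tractorDeriv G x (fun τ ↦ ∑ l ∈ Finset.range m, c l τ • V l τ) t =
      ∑ l ∈ Finset.range m, (deriv (c l) t • V l t + c l t • tractorDeriv G x (V l) t) := by
  induction m with
  | zero =>
    have : tractorDeriv G x (fun τ ↦ (0 : ℝ) • (0 : Tractor n)) t = 0 := by
      rw [tractorDeriv_smul (differentiableAt_const _) (differentiableAt_const _)]
      simp
    simpa using this
  | succ m ih =>
    simp only [Finset.sum_range_succ]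
    rw [tractorDeriv_add (V := fun τ ↦ ∑ l ∈ Finset.range m, c l τ • V l τ)
      (W := fun τ ↦ c m τ • V m τ)
      (DifferentiableAt.fun_sum fun l _ ↦ (hc l).smul (hV l)) ((hc m).smul (hV m)), ih,
      tractorDeriv_smul (hc m) (hV m)]

/-- `y` is the curve `x`, reparametrized by `s : I → S`. -/
structure IsReparametrization (x y : ℝ → EuclideanSpace ℝ (Fin n)) (s : ℝ → ℝ) (I S : Set ℝ) :
    Prop where
  isOpen : IsOpen S
  contDiffOn : ContDiffOn ℝ ∞ y S
  contDiffOn_param : ContDiffOn ℝ ∞ s I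
  image_eq : s '' I = S
  apply_eq : ∀ t ∈ I, y (s t) = x t
  deriv_pos : ∀ t ∈ I, 0 < deriv s t

namespace IsReparametrization

variable {y : ℝ → EuclideanSpace ℝ (Fin n)} {s : ℝ → ℝ} {S : Set ℝ}
  (hr : IsReparametrization x y s I S) (hI : IsOpen I)
include hr

theorem mem {t : ℝ} (ht : t ∈ I) : s t ∈ S := hr.image_eq ▸ Set.mem_image_of_mem s ht

theorem differentiableAt {F : Type*} [NormedAddCommGroup F] [NormedSpace ℝ F] {f : ℝ → F}
    (hf : ContDiffOn ℝ ∞ f S) {t : ℝ} (ht : t ∈ I) : DifferentiableAt ℝ f (s t) :=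
  (hf.contDiffAt (hr.isOpen.mem_nhds (hr.mem ht))).differentiableAt (by simp)

include hI

theorem differentiableAt_param {t : ℝ} (ht : t ∈ I) : DifferentiableAt ℝ s t :=
  (hr.contDiffOn_param.contDiffAt (hI.mem_nhds ht)).differentiableAt (by simp)

theorem contDiffOn_deriv_param : ContDiffOn ℝ ∞ (deriv s) I :=
  hr.contDiffOn_param.deriv_of_isOpen hI (by simp)

theorem deriv_eq {t : ℝ} (ht : t ∈ I) : deriv x t = deriv s t • deriv y (s t) := by
  have h1 : (y ∘ s) =ᶠ[nhds t] x :=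
    Filter.eventuallyEq_of_mem (hI.mem_nhds ht) fun τ hτ ↦ hr.apply_eq τ hτ
  rw [← h1.deriv_eq]
  exact ((hr.differentiableAt hr.contDiffOn ht).hasDerivAt.scomp t
    (hr.differentiableAt_param hI ht).hasDerivAt).deriv

theorem covDeriv_comp {v : ℝ → EuclideanSpace ℝ (Fin n)} {t : ℝ} (ht : t ∈ I)
    (hv : DifferentiableAt ℝ v (s t)) :
    covDeriv G x (fun τ ↦ v (s τ)) t = deriv s t • covDeriv G y v (s t) := by
  ext k
  have h1 : deriv (fun τ ↦ v (s τ) k) t = deriv (fun σ ↦ v σ k) (s t) * deriv s t :=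
    ((differentiableAt_coord hv k).hasDerivAt.comp t
      (hr.differentiableAt_param hI ht).hasDerivAt).deriv
  have h2 : connectionMatrix G x t = deriv s t • connectionMatrix G y (s t) := by
    ext i j
    simp only [connectionMatrix, hr.deriv_eq hI ht, hr.apply_eq t ht, Matrix.of_apply,
      Matrix.smul_apply, smul_eq_mul, PiLp.smul_apply, Finset.mul_sum]
    exact Finset.sum_congr rfl fun l _ ↦ by ring
  simp only [PiLp.smul_apply, covDeriv_apply, h1, h2, Matrix.smul_mulVec, Pi.smul_apply,
    smul_eq_mul]
  ring

theorem tractorDeriv_comp {V : ℝ → Tractor n} {t : ℝ} (ht : t ∈ I)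
    (hV : DifferentiableAt ℝ V (s t)) :
    tractorDeriv G x (fun τ ↦ V (s τ)) t = deriv s t • tractorDeriv G y V (s t) := by
  have hs := (hr.differentiableAt_param hI ht).hasDerivAt
  have h1 : deriv (fun τ ↦ (V (s τ)).1) t = deriv (fun σ ↦ (V σ).1) (s t) * deriv s t :=
    (hV.fst.hasDerivAt.comp t hs).deriv
  have h2 : deriv (fun τ ↦ (V (s τ)).2.2) t = deriv (fun σ ↦ (V σ).2.2) (s t) * deriv s t :=
    (hV.snd.snd.hasDerivAt.comp t hs).deriv
  have h3 := hr.covDeriv_comp (G := G) hI ht hV.snd.fst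
  have hU := hr.deriv_eq hI ht
  refine Prod.ext ?_ (Prod.ext ?_ ?_)
  · simp only [tractorDeriv, h1, hU, hr.apply_eq t ht, Prod.smul_fst, metricAt_eq_dotProduct,
      WithLp.ofLp_smul, smul_dotProduct, smul_eq_mul]
    ring
  · have h4 : (WithLp.toLp 2 (fun b ↦ ∑ c, (G (x t))⁻¹ b c *
          ∑ a, schouten G (x t) a c * (deriv x t) a) : EuclideanSpace ℝ (Fin n)) =
        deriv s t • WithLp.toLp 2 (fun b ↦ ∑ c, (G (x t))⁻¹ b c *
          ∑ a, schouten G (x t) a c * (deriv y (s t)) a) := by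
      ext b
      simp only [hU, PiLp.smul_apply, smul_eq_mul, Finset.mul_sum]
      exact Finset.sum_congr rfl fun c _ ↦ Finset.sum_congr rfl fun a _ ↦ by ring
    simp only [tractorDeriv, h4, h3, Prod.smul_snd, Prod.smul_fst, hr.apply_eq t ht]
    rw [hU]
    module
  · simp only [tractorDeriv, h2, hU, hr.apply_eq t ht, Prod.smul_snd, PiLp.smul_apply, smul_eq_mul,
      mul_sub, Finset.mul_sum]
    rw [mul_comm (deriv s t)]
    congr 1
    exact Finset.sum_congr rfl fun a _ ↦ Finset.sum_congr rfl fun c _ ↦ by ring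

theorem acceleration_eq {t : ℝ} (ht : t ∈ I) : acceleration G x t =
    deriv (deriv s) t • deriv y (s t) + deriv s t ^ 2 • acceleration G y (s t) := by
  have hy := hr.differentiableAt (hr.contDiffOn.deriv_of_isOpen hr.isOpen (by simp)) ht
  have hs := hr.differentiableAt_param hI ht
  have hs' : DifferentiableAt ℝ (deriv s) t :=
    ((hr.contDiffOn_deriv_param hI).contDiffAt (hI.mem_nhds ht)).differentiableAt (by simp)
  have h1 : deriv x =ᶠ[nhds t] fun τ ↦ deriv s τ • deriv y (s τ) :=
    Filter.eventuallyEq_of_mem (hI.mem_nhds ht) fun τ hτ ↦ hr.deriv_eq hI hτ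
  rw [acceleration, covDeriv_congr h1,
    covDeriv_smul (v := fun τ ↦ deriv y (s τ)) hs' (hy.comp t hs),
    hr.covDeriv_comp hI ht hy, acceleration]
  module

omit hI

variable (h : IsNullOn G Ω x I)
include h

/-- The new acceleration is `w⁻²` times the old one plus a multiple of `U`. That multiple does not
contribute, as `U` is null and orthogonal to `U'`. Hence `u` scales by `w⁻²`. -/
theorem metricAt_acceleration {t : ℝ} (ht : t ∈ I) :
    metricAt G (y (s t)) (acceleration G y (s t)) (acceleration G y (s t)) =
      metricAt G (x t) (acceleration G x t) (acceleration G x t) / (deriv s t ^ 2) ^ 2 := by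
  have hs := (hr.deriv_pos t ht).ne'
  have hn := h.null t ht
  have h1 := h.metricAt_acceleration ht
  have h2 := h1
  rw [h.metric.metricAt_comm (h.mapsTo ht)] at h2
  have ha := hr.acceleration_eq (G := G) h.isOpen ht
  have hU := hr.deriv_eq h.isOpen ht
  have e : acceleration G y (s t) = (deriv s t ^ 2)⁻¹ •
      (acceleration G x t - (deriv (deriv s) t * (deriv s t)⁻¹) • deriv x t) := by
    rw [ha, hU, smul_smul, inv_mul_cancel_right₀ hs, add_sub_cancel_left, smul_smul,
      inv_mul_cancel₀ (pow_ne_zero 2 hs), one_smul]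
  rw [hr.apply_eq t ht, e]
  simp only [metricAt_eq_dotProduct] at hn h1 h2 ⊢
  simp only [WithLp.ofLp_smul, WithLp.ofLp_sub, Matrix.mulVec_smul, Matrix.mulVec_sub,
    smul_dotProduct, dotProduct_smul, sub_dotProduct, dotProduct_sub, hn, h1, h2, smul_eq_mul]
  field_simp
  ring

theorem isNullOn : IsNullOn G Ω y S where
  metric := h.metric
  isOpen := hr.isOpen
  contDiffOn := hr.contDiffOn
  mapsTo := by
    rw [← hr.image_eq]
    rintro _ ⟨t, ht, rfl⟩
    rw [hr.apply_eq t ht]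
    exact h.mapsTo ht
  null := by
    rw [← hr.image_eq]
    rintro _ ⟨t, ht, rfl⟩
    have h1 := h.null t ht
    have hs := (hr.deriv_pos t ht).ne'
    rw [hr.deriv_eq h.isOpen ht] at h1
    rw [hr.apply_eq t ht]
    simp only [metricAt_eq_dotProduct] at h1 ⊢
    simpa [Matrix.mulVec_smul, hs] using h1
  acceleration_pos := by
    rw [← hr.image_eq]
    rintro _ ⟨t, ht, rfl⟩
    rw [hr.metricAt_acceleration h ht]
    have := hr.deriv_pos t ht
    have := h.acceleration_pos t ht
    positivity

/-- Under a change of parameter the derived sequence changes by a triangular matrix. -/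
theorem exists_derived_eq_sum (j : ℕ) : ∃ c : ℕ → ℝ → ℝ, (∀ l, ContDiffOn ℝ ∞ (c l) I) ∧
    (∀ l, j < l → c l = 0) ∧ (∀ t ∈ I, c j t = deriv s t ^ 2 * (deriv s t)⁻¹ ^ j) ∧
    ∀ t ∈ I, derived G y j (s t) = ∑ l ∈ Finset.range (j + 1), c l t • derived G x l t := by
  have hs' := hr.contDiffOn_deriv_param h.isOpen
  induction j with
  | zero =>
    refine ⟨fun l ↦ if l = 0 then fun t ↦ deriv s t ^ 2 else 0, fun l ↦ ?_, fun l hl ↦ ?_,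
      fun t _ ↦ ?_, fun t ht ↦ ?_⟩
    · by_cases hl : l = 0
      · simpa [hl] using hs'.pow 2
      · simp only [hl, if_false]
        exact contDiffOn_const (c := (0 : ℝ))
    · simp [hl.ne']
    · simp
    · have hs := hr.deriv_pos t ht
      have e : √(metricAt G (y (s t)) (acceleration G y (s t)) (acceleration G y (s t))) =
          √(metricAt G (x t) (acceleration G x t) (acceleration G x t)) / deriv s t ^ 2 := by
        rw [hr.metricAt_acceleration h ht, Real.sqrt_div' _ (by positivity),
          Real.sqrt_sq (by positivity)]
      simp [derived, e, div_eq_mul_inv]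
  | succ j ih =>
    obtain ⟨c, hc, hc0, hcj, hcd⟩ := ih
    have hinv : ContDiffOn ℝ ∞ (fun t ↦ (deriv s t)⁻¹) I :=
      hs'.inv fun t ht ↦ (hr.deriv_pos t ht).ne'
    have hshift : ∀ l, ContDiffOn ℝ ∞ (Nat.rec (0 : ℝ → ℝ) (fun l _ ↦ c l) l : ℝ → ℝ) I := by
      rintro (_ | l)
      · exact contDiffOn_const
      · exact hc l
    -- Applying `w⁻¹ d/dt` to `∑ c_l • derived l` gives the coefficients `w⁻¹ (c_l' + c_{l-1})`. The
    -- `Nat.rec` is the index shift with `c_{-1} = 0`.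
    refine ⟨fun l t ↦ (deriv s t)⁻¹ *
      (deriv (c l) t + (Nat.rec (0 : ℝ → ℝ) (fun l _ ↦ c l) l : ℝ → ℝ) t), fun l ↦
      hinv.mul ((h.contDiffOn_deriv (hc l)).add (hshift l)), fun l hl ↦ ?_, fun t ht ↦ ?_,
      fun t ht ↦ ?_⟩
    · obtain ⟨l, rfl⟩ := Nat.exists_eq_succ_of_ne_zero (by omega : l ≠ 0)
      funext t
      simp [hc0 l (by omega), hc0 (l + 1) (by omega), Pi.zero_def]
    · simp only [hc0 (j + 1) (by omega), hcj t ht]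
      simp only [Pi.zero_def, deriv_const]
      ring
    · have hs := (hr.deriv_pos t ht).ne'
      have h1 := hr.tractorDeriv_comp (G := G) h.isOpen ht
        (hr.differentiableAt ((hr.isNullOn h).contDiffOn_derived j) ht)
      have h2 : (fun τ ↦ derived G y j (s τ)) =ᶠ[nhds t]
          fun τ ↦ ∑ l ∈ Finset.range (j + 1), c l τ • derived G x l τ :=
        Filter.eventuallyEq_of_mem (h.isOpen.mem_nhds ht) fun τ hτ ↦ hcd τ hτ
      rw [tractorDeriv_congr h2, tractorDeriv_sum_smul (fun l ↦ h.differentiableAt (hc l) ht)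
        (fun l ↦ h.differentiableAt (h.contDiffOn_derived l) ht)] at h1
      have h3 : derived G y (j + 1) (s t) = (deriv s t)⁻¹ • (deriv s t •
          tractorDeriv G y (derived G y j) (s t)) := by
        rw [smul_smul, inv_mul_cancel₀ hs, one_smul, derived]
      simp only [h3, ← h1, mul_smul, ← Finset.smul_sum, add_smul, Finset.sum_add_distrib]
      congr 2
      · rw [Finset.sum_range_succ _ (j + 1), hc0 (j + 1) (by omega)]
        simp [Pi.zero_def]
      · rw [Finset.sum_range_succ' _ (j + 1)]
        simp [derived]

theorem derived_sub_mem {t : ℝ} (ht : t ∈ I) (j : ℕ) :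
    derived G y j (s t) - (deriv s t ^ 2 * (deriv s t)⁻¹ ^ j) • derived G x j t ∈
      flag (fun j ↦ derived G x j t) j := by
  obtain ⟨c, -, -, hcj, hcd⟩ := hr.exists_derived_eq_sum h j
  rw [hcd t ht, Finset.sum_range_succ, hcj t ht, add_sub_cancel_right]
  exact sum_mem fun l hl ↦ Submodule.smul_mem _ _
    (mem_flag (fun j ↦ derived G x j t) (Finset.mem_range.1 hl))

theorem gramDet_eq {t : ℝ} (ht : t ∈ I) (m : ℕ) : gramDet G y m (s t) =
    (∏ j ∈ Finset.range m, deriv s t ^ 2 * (deriv s t)⁻¹ ^ j) ^ 2 * gramDet G x m t := by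
  rw [gramDet_eq_gram, gramDet_eq_gram, hr.apply_eq t ht]
  exact gram_triangular _ fun j _ ↦ hr.derived_sub_mem h ht j

/-- The higher conformal curvatures of `y` in terms of the Gram determinants of `x`. -/
theorem higherCurvature_eq {N : ℕ}
    (hgen : ∀ t ∈ I, ∀ j < N, derived G x j t ∉ flag (fun j ↦ derived G x j t) j)
    {i : ℕ} (hi : 3 ≤ i) (hiN : i + 3 < N) {t : ℝ} (ht : t ∈ I) :
    higherCurvature G y i (s t) = √(gramDet G x (i + 2) t * gramDet G x (i + 4) t) /
      (gramDet G x (i + 3) t * deriv s t) := by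
  have hgen' : ∀ σ ∈ S, ∀ j < N, derived G y j σ ∉ flag (fun j ↦ derived G y j σ) j := by
    rw [← hr.image_eq]
    rintro _ ⟨τ, hτ, rfl⟩
    refine notMem_flag_of_triangular (fun j _ ↦ ⟨_, ?_, hr.derived_sub_mem h hτ j⟩) (hgen τ hτ)
    have := (hr.deriv_pos τ hτ).ne'
    positivity
  have hw := hr.deriv_pos t ht
  rw [(hr.isNullOn h).higherCurvature_eq hgen' hi hiN (hr.mem ht), hr.gramDet_eq h ht,
    hr.gramDet_eq h ht, hr.gramDet_eq h ht, show i + 4 = i + 2 + 1 + 1 from rfl,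
    show i + 3 = i + 2 + 1 from rfl, Finset.prod_range_succ _ (i + 2 + 1),
    Finset.prod_range_succ _ (i + 2)]
  set w := deriv s t
  have hP : 0 < ∏ j ∈ Finset.range (i + 2), w ^ 2 * w⁻¹ ^ j :=
    Finset.prod_pos fun j _ ↦ by positivity
  set P := ∏ j ∈ Finset.range (i + 2), w ^ 2 * w⁻¹ ^ j
  -- The three determinants scale by `P²`, `(P a)²` and `(P a (a w⁻¹))²`, since consecutive diagonal
  -- entries differ by `w⁻¹`. The quotient thus scales by `w⁻¹`.
  set a := w ^ 2 * w⁻¹ ^ (i + 2) with ha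
  have ha0 : 0 < a := by positivity
  have hb : w ^ 2 * w⁻¹ ^ (i + 2 + 1) = a * w⁻¹ := by rw [ha]; ring
  have e : ∀ g g' : ℝ, P ^ 2 * g * ((P * a * (a * w⁻¹)) ^ 2 * g') =
      (P ^ 2 * a ^ 2 * w⁻¹) ^ 2 * (g * g') := fun g g' ↦ by ring
  rw [hb, e, Real.sqrt_mul (sq_nonneg _), Real.sqrt_sq (by positivity)]
  rw [show (P * a) ^ 2 * gramDet G x (i + 2 + 1) t = (P ^ 2 * a ^ 2) * gramDet G x (i + 2 + 1) t
    by ring, mul_assoc (P ^ 2 * a ^ 2), mul_div_mul_left _ _ (by positivity)]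
  rw [inv_mul_eq_div, div_div, mul_comm w]

end IsReparametrization

/-- Nothing is assumed about `y` beyond `y ∘ s = x`. By the inverse function theorem `y = x ∘ s⁻¹`
on a neighbourhood of `s t₀`, so it is smooth there. -/
theorem IsNullOn.exists_isReparametrization (h : IsNullOn G Ω x I) {s : ℝ → ℝ}
    {y : ℝ → EuclideanSpace ℝ (Fin n)} (hs : ContDiffOn ℝ ∞ s I) (hpos : ∀ t ∈ I, 0 < deriv s t)
    (hy : ∀ t ∈ I, y (s t) = x t) {t₀ : ℝ} (ht₀ : t₀ ∈ I) :
    ∃ I' ⊆ I, IsOpen I' ∧ t₀ ∈ I' ∧ ∃ S, IsReparametrization x y s I' S := by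
  have hat := hs.contDiffAt (h.isOpen.mem_nhds ht₀)
  have hd : ∀ t ∈ I, HasDerivAt s (deriv s t) t := fun t ht ↦ (h.differentiableAt hs ht).hasDerivAt
  set e := hat.toOpenPartialHomeomorph s
    ((hd t₀ ht₀).hasFDerivAt_equiv (hpos t₀ ht₀).ne') (by simp)
  have hcoe : (e : ℝ → ℝ) = s := rfl
  have hmem : t₀ ∈ e.source := hat.mem_toOpenPartialHomeomorph_source _ _
  refine ⟨I ∩ e.source, Set.inter_subset_left, h.isOpen.inter e.open_source, ⟨ht₀, hmem⟩,
    s '' (I ∩ e.source), ?_, ?_, hs.mono Set.inter_subset_left, rfl, fun t ht ↦ hy t ht.1,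
    fun t ht ↦ hpos t ht.1⟩
  · exact e.isOpen_image_of_subset_source (h.isOpen.inter e.open_source) Set.inter_subset_right
  · have h1 : ContDiffOn ℝ ∞ e.symm (s '' (I ∩ e.source)) := by
      rintro _ ⟨t, ht, rfl⟩
      have hl : e.symm (s t) = t := e.left_inv ht.2
      refine (e.contDiffAt_symm_deriv (hpos t ht.1).ne' (e.map_source ht.2) ?_ ?_).contDiffWithinAt
      · rw [e.left_inv ht.2]
        exact hd t ht.1
      · rw [e.left_inv ht.2]
        exact hs.contDiffAt (h.isOpen.mem_nhds ht.1)
    refine (h.contDiffOn.comp h1 ?_).congr ?_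
    · rintro _ ⟨t, ht, rfl⟩
      exact (e.left_inv ht.2).symm ▸ ht.1
    · rintro _ ⟨t, ht, rfl⟩
      have hl : e.symm (s t) = t := e.left_inv ht.2
      rw [Function.comp_apply, hl, hy t ht.1]

end NullCurves

/-! ### From a Lorentzian metric on the manifold to its matrix in a chart. -/

section Manifold

theorem mfderiv_symm_bijective {n : ℕ} {M : Type*} [TopologicalSpace M]
    [ChartedSpace (EuclideanSpace ℝ (Fin n)) M]
    {φ : OpenPartialHomeomorph M (EuclideanSpace ℝ (Fin n))} (hφ : φ ∈ IsManifold.maximalAtlas (𝓡 n) ∞ M)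
    {y : EuclideanSpace ℝ (Fin n)} (hy : y ∈ φ.target) :
    Function.Bijective (mfderiv (𝓡 n) (𝓡 n) φ.symm y) := by
  have h : φ.MDifferentiable (𝓡 n) (𝓡 n) :=
    ⟨(contMDiffOn_of_mem_maximalAtlas hφ).mdifferentiableOn (by simp),
      (contMDiffOn_symm_of_mem_maximalAtlas hφ).mdifferentiableOn (by simp)⟩
  exact h.symm.mfderiv_bijective hy

variable {n : ℕ} {M : Type*} [TopologicalSpace M] [ChartedSpace (EuclideanSpace ℝ (Fin n)) M]
  [IsManifold (𝓡 n) ∞ M] (g : LorentzianMetric n M)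
  {φ : OpenPartialHomeomorph M (EuclideanSpace ℝ (Fin n))}

/-- The field is the tangent map of `φ.symm` applied to a constant field. -/
theorem contMDiffOn_coordinateField (hφ : φ ∈ IsManifold.maximalAtlas (𝓡 n) ∞ M)
    (v : EuclideanSpace ℝ (Fin n)) :
    ContMDiffOn (𝓡 n) ((𝓡 n).prod (𝓡 n)) ∞
      (fun y ↦ Bundle.TotalSpace.mk' (EuclideanSpace ℝ (Fin n))
        (E := fun p : M ↦ TangentSpace (𝓡 n) p) (φ.symm y) (mfderiv (𝓡 n) (𝓡 n) φ.symm y v))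
      φ.target := by
  have h1 := contMDiffOn_symm_of_mem_maximalAtlas hφ
  have h2 := h1.contMDiffOn_tangentMapWithin (m := ∞) (by simp)
    (φ.open_target.uniqueMDiffOn)
  have h3 : ContMDiffOn (𝓡 n) ((𝓡 n).prod (𝓡 n)) ∞
      (fun y : EuclideanSpace ℝ (Fin n) ↦ Bundle.TotalSpace.mk' (EuclideanSpace ℝ (Fin n))
        (E := fun p : EuclideanSpace ℝ (Fin n) ↦ TangentSpace (𝓡 n) p) y v) φ.target :=
    contMDiffOn_vectorSpace_iff_contDiffOn.2 contDiffOn_const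
  refine (h2.comp h3 fun y hy ↦ hy).congr fun y hy ↦ ?_
  simp only [Function.comp_apply, tangentMapWithin]
  rw [mfderivWithin_of_isOpen φ.open_target hy]

theorem contDiffOn_inChart (hφ : φ ∈ IsManifold.maximalAtlas (𝓡 n) ∞ M) (i j : Fin n) :
    ContDiffOn ℝ ∞ (fun y ↦ g.inChart φ y i j) φ.target := by
  rw [← contMDiffOn_iff_contDiffOn]
  have hb : ContMDiffOn (𝓡 n) (𝓡 n) ∞ φ.symm φ.target := contMDiffOn_symm_of_mem_maximalAtlas hφ
  have h1 : ContMDiffOn (𝓡 n) ((𝓡 n).prod 𝓘(ℝ)) ∞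
      (fun y ↦ Bundle.TotalSpace.mk' ℝ (E := Bundle.Trivial M ℝ) (φ.symm y)
        (g.val (φ.symm y) (mfderiv (𝓡 n) (𝓡 n) φ.symm y (EuclideanSpace.single i (1 : ℝ)))
          (mfderiv (𝓡 n) (𝓡 n) φ.symm y (EuclideanSpace.single j (1 : ℝ))))) φ.target := by
    apply ContMDiffOn.clm_bundle_apply₂ (F₁ := EuclideanSpace ℝ (Fin n))
      (F₂ := EuclideanSpace ℝ (Fin n))
    · exact g.contMDiff.comp_contMDiffOn hb
    · exact contMDiffOn_coordinateField hφ _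
    · exact contMDiffOn_coordinateField hφ _
  intro y hy
  have := h1 y hy
  simp only [Bundle.contMDiffWithinAt_totalSpace] at this
  exact this.2

theorem metricAt_inChart (y v w : EuclideanSpace ℝ (Fin n)) :
    metricAt (g.inChart φ) y v w = g.val (φ.symm y) (mfderiv (𝓡 n) (𝓡 n) φ.symm y v)
      (mfderiv (𝓡 n) (𝓡 n) φ.symm y w) := by
  have hu : ∀ u : EuclideanSpace ℝ (Fin n), mfderiv (𝓡 n) (𝓡 n) φ.symm y u =
      ∑ i, u i • mfderiv (𝓡 n) (𝓡 n) φ.symm y (EuclideanSpace.single i (1 : ℝ)) := fun u ↦ by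
    have : u = ∑ i, u i • EuclideanSpace.single i (1 : ℝ) := by
      ext j
      simp [Pi.single_apply]
    conv_lhs => rw [this]
    exact (map_sum (mfderiv (𝓡 n) (𝓡 n) φ.symm y) _ _).trans
      (Finset.sum_congr rfl fun i _ ↦ map_smul (mfderiv (𝓡 n) (𝓡 n) φ.symm y) _ _)
  rw [hu v, hu w]
  simp only [map_sum, map_smul, sum_apply, smul_apply,
    metricAt, LorentzianMetric.inChart, Matrix.of_apply, smul_eq_mul, Finset.mul_sum]
  rw [Finset.sum_comm]
  refine Finset.sum_congr rfl fun i _ ↦ Finset.sum_congr rfl fun j _ ↦ ?_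
  ring

theorem LorentzianMetric.exists_basis (p : M) :
    ∃ (b : Module.Basis (Fin n) ℝ (TangentSpace (𝓡 n) p)) (k : Fin n), ∀ v w,
      g.val p v w = ∑ i, (if i = k then -1 else 1) * b.repr v i * b.repr w i := by
  obtain ⟨b, k, hb⟩ := g.signature p
  refine ⟨b, k, fun v w ↦ ?_⟩
  conv_lhs => rw [← b.sum_repr v, ← b.sum_repr w]
  simp only [map_sum, map_smul, sum_apply, smul_apply, smul_eq_mul, hb, mul_ite, mul_zero,
    Finset.sum_ite_eq',
    Finset.mem_univ, if_true]
  refine Finset.sum_congr rfl fun i _ ↦ ?_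
  split_ifs <;> ring

theorem LorentzianMetric.eq_zero_of_forall {p : M} {v : TangentSpace (𝓡 n) p}
    (h : ∀ w, g.val p v w = 0) : v = 0 := by
  obtain ⟨b, k, hb⟩ := g.exists_basis p
  refine b.ext_elem fun i ↦ ?_
  have := h (b i)
  rw [hb, Finset.sum_eq_single i (fun j _ hj ↦ by simp [Finsupp.single_eq_of_ne hj])
    (by simp)] at this
  split_ifs at this <;> simpa using this

theorem isMetricOn_inChart (hφ : φ ∈ IsManifold.maximalAtlas (𝓡 n) ∞ M) :
    IsMetricOn (g.inChart φ) φ.target where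
  isOpen := φ.open_target
  contDiffOn := contDiffOn_inChart g hφ
  symm y _ i j := g.symm _ _ _
  det_ne_zero y hy := by
    intro hdet
    obtain ⟨v, hv, hGv⟩ := Matrix.exists_mulVec_eq_zero_iff.2 hdet
    have hbij := mfderiv_symm_bijective hφ hy
    have hm : ∀ u, metricAt (g.inChart φ) y u (WithLp.toLp 2 v) = 0 := fun u ↦ by
      rw [metricAt_eq_dotProduct, WithLp.ofLp_toLp, hGv, dotProduct_zero]
    have h0 : mfderiv (𝓡 n) (𝓡 n) φ.symm y (WithLp.toLp 2 v) = 0 := by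
      refine g.eq_zero_of_forall fun w ↦ ?_
      obtain ⟨u, rfl⟩ := hbij.2 w
      rw [g.symm]
      exact (metricAt_inChart g y u (WithLp.toLp 2 v)).symm.trans (hm u)
    have h1 : (WithLp.toLp 2 v : EuclideanSpace ℝ (Fin n)) = 0 :=
      hbij.1 (h0.trans (map_zero (mfderiv (𝓡 n) (𝓡 n) φ.symm y)).symm)
    exact hv (by simpa using h1)
  index y hy := by
    obtain ⟨b, k, hb⟩ := g.exists_basis (φ.symm y)
    -- On the kernel of the coordinate along the negative basis vector, the metric is a sum of
    -- squares of the other coordinates.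
    refine ⟨b.coord k ∘ₗ (mfderiv (𝓡 n) (𝓡 n) φ.symm y).toLinearMap, fun v hv hk ↦ ?_⟩
    have hk : b.repr (mfderiv (𝓡 n) (𝓡 n) φ.symm y v) k = 0 := hk
    have hne : mfderiv (𝓡 n) (𝓡 n) φ.symm y v ≠ 0 := fun h0 ↦ hv <|
      (mfderiv_symm_bijective hφ hy).1 (h0.trans (map_zero (mfderiv (𝓡 n) (𝓡 n) φ.symm y)).symm)
    have hterm : ∀ i, (if i = k then (-1 : ℝ) else 1) *
        b.repr (mfderiv (𝓡 n) (𝓡 n) φ.symm y v) i * b.repr (mfderiv (𝓡 n) (𝓡 n) φ.symm y v) i =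
        b.repr (mfderiv (𝓡 n) (𝓡 n) φ.symm y v) i ^ 2 := fun i ↦ by
      split_ifs with h
      · subst h
        simp [hk]
      · ring
    rw [metricAt_inChart, hb]
    simp only [hterm]
    refine lt_of_le_of_ne (Finset.sum_nonneg fun i _ ↦ sq_nonneg _) fun h0 ↦ hne ?_
    refine b.ext_elem fun i ↦ ?_
    have := (Finset.sum_eq_zero_iff_of_nonneg fun i _ ↦ sq_nonneg _).1 h0.symm i (Finset.mem_univ i)
    simpa using this

end Manifold

end ConfCurve

/-! ### The theorem, by localization to a chart. -/

theorem mainTheorem3 {n : ℕ} (hn : 4 ≤ n) {M : Type*} [TopologicalSpace M] [T2Space M]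
    [SecondCountableTopology M]
    [ChartedSpace (EuclideanSpace ℝ (Fin n)) M] [IsManifold (𝓡 n) ∞ M]
    (c : ConfCurve.LorentzianConformalStructure n M)
    -- a generic null curve with an arbitrary parameter `t` in the open interval `J`
    (γ : ℝ → M) (J : Set ℝ) (hJ : IsOpen J) (hJc : J.OrdConnected)
    (hγ : ContMDiffOn 𝓘(ℝ, ℝ) (𝓡 n) ∞ γ J)
    (hnull : ConfCurve.IsNullCurve c γ J) (hgen : ConfCurve.IsGenericCurve c γ J)
    -- the same curve `γs`, parametrized by a conformal pseudo-arc-length `s`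
    (s : ℝ → ℝ) (hs : ConfCurve.IsPseudoArcLength c γ J s)
    (γs : ℝ → M) (hγs : ∀ t ∈ J, γs (s t) = γ t)
    (i : ℕ) (hi : 3 ≤ i) (hin : i + 2 ≤ n) :
    -- in every scale, in every chart, at every point of the curve
    ∀ g ∈ c.metrics, ∀ φ ∈ IsManifold.maximalAtlas (𝓡 n) ∞ M, ∀ t ∈ J, γ t ∈ φ.source →
      ConfCurve.higherCurvature (g.inChart φ) (φ ∘ γs) i (s t) =
        √(ConfCurve.gramDet (g.inChart φ) (φ ∘ γ) (i + 2) t *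
            ConfCurve.gramDet (g.inChart φ) (φ ∘ γ) (i + 4) t) /
          (ConfCurve.gramDet (g.inChart φ) (φ ∘ γ) (i + 3) t *
            ConfCurve.gramDet (g.inChart φ) (φ ∘ γ) 6 t ^ (1 / 6 : ℝ)) := by
  intro g hg φ hφ t₀ ht₀ hsrc
  set I := J ∩ γ ⁻¹' φ.source with hI
  have h : ConfCurve.IsNullOn (g.inChart φ) φ.target (φ ∘ γ) I :=
    { metric := ConfCurve.isMetricOn_inChart g hφ
      isOpen := hγ.continuousOn.isOpen_inter_preimage hJ φ.open_source
      contDiffOn := contMDiffOn_iff_contDiffOn.1 <|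
        (contMDiffOn_of_mem_maximalAtlas hφ).comp (hγ.mono Set.inter_subset_left)
          fun t ht ↦ ht.2
      mapsTo := fun t ht ↦ φ.map_source ht.2
      null := fun t ht ↦ (hnull g hg φ hφ t ht.1 ht.2).2.1
      acceleration_pos := fun t ht ↦
        ConfCurve.acceleration_pos_of_isGenericAt (hgen g hg φ hφ t ht.1 ht.2) }
  have hflag := fun t (ht : t ∈ I) ↦
    ConfCurve.notMem_flag_of_isGenericAt (hgen g hg φ hφ t ht.1 ht.2)
  -- Needs six independent derived tractors, hence `6 ≤ n + 2`.
  have hΔ : ∀ t ∈ I, 0 < ConfCurve.gramDet (g.inChart φ) (φ ∘ γ) 6 t := fun t ht ↦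
    (h.isGramSchmidt ht (hflag t ht)).gram_pos (by norm_num) (by omega)
  have hsd : ∀ t ∈ I, HasDerivAt s
      (ConfCurve.gramDet (g.inChart φ) (φ ∘ γ) 6 t ^ (1 / 6 : ℝ)) t := fun t ht ↦
    hs g hg φ hφ t ht.1 ht.2
  -- Only the derivative of `s` is prescribed. It is smooth because `Δ₆` is smooth and does not
  -- vanish.
  have hsm : ContDiffOn ℝ ∞ s I := by
    refine (contDiffOn_infty_iff_deriv_of_isOpen h.isOpen).2
      ⟨fun t ht ↦ (hsd t ht).differentiableAt.differentiableWithinAt, ?_⟩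
    exact ((h.contDiffOn_gramDet 6).rpow_const_of_ne fun t ht ↦ (hΔ t ht).ne').congr
      fun t ht ↦ (hsd t ht).deriv
  have ht : t₀ ∈ I := ⟨ht₀, hsrc⟩
  obtain ⟨I', hI', hopen, ht', S, hr⟩ := h.exists_isReparametrization (y := φ ∘ γs) hsm
    (fun t ht ↦ (hsd t ht).deriv ▸ Real.rpow_pos_of_pos (hΔ t ht) _)
    (fun t ht ↦ congrArg φ (hγs t ht.1)) ht
  have h' : ConfCurve.IsNullOn (g.inChart φ) φ.target (φ ∘ γ) I' :=
    { h with
      isOpen := hopen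
      contDiffOn := h.contDiffOn.mono hI'
      mapsTo := h.mapsTo.mono_left hI'
      null := fun t ht ↦ h.null t (hI' ht)
      acceleration_pos := fun t ht ↦ h.acceleration_pos t (hI' ht) }
  rw [hr.higherCurvature_eq h' (fun t ht ↦ hflag t (hI' ht)) hi (by omega) ht',
    (hsd t₀ ht).deriv]
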